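/- Let $d\ge 3$ and $n\ge 1$. For real $n\times\dots\times n$ tensors of order $d$, let $\|\cdot\|_F$ denote the Frobenius norm, and let the rank of a tensor be the least number of elementary tensors $u_1\otimes\dots\otimes u_d$ ($u_i\in\mathbb{R}^n$) of which it is a sum. If $A\neq 0$ is a real symmetric tensor of order $d$ and rank at most two, then \[ \min_{\operatorname{rank} B\le 1}\frac{\|A-B\|_F}{\|A\|_F}<\sqrt{1-\left(1-\frac1d\right)^{d-1}}, \] where the minimum, which is attained, is over all real tensors $B$ of the same format and of rank at most one. This bound is sharp: for every $n\ge 2$ the right-hand side is the supremum of the left-hand side over all nonzero symmetric tensors $A$ of rank at most two. Moreover, for $n\ge 2$, let $e_1,e_2$ be the first two standard basis vectors of $\mathbb{R}^n$, write $u^d=u\otimes\dots\otimes u$, and let $e_1^{d-1}e_2$ denote the symmetrization (average over all permutations of the factors) of $e_1\otimes\dots\otimes e_1\otimes e_2$. Then the nonzero symmetric tensor \[ W_d=\lim_{t\to0}\frac1t\left[(e_1+te_2)^d-e_1^d\right]=d\,e_1^{d-1}e_2 \] satisfies \[ \min_{\operatorname{rank} B\le 1}\frac{\|W_d-B\|_F}{\|W_d\|_F}=\sqrt{1-\left(1-\frac1d\right)^{d-1}}.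 \] -/

import Mathlib

open Filter Topology

noncomputable section

namespace RealTensor

/-- Real `n × ⋯ × n` tensors of order `d`, indexed by `(i_1, …, i_d)`. The norm of this Euclidean
space is the Frobenius norm. -/
abbrev Tensor (d n : ℕ) : Type := EuclideanSpace ℝ (Fin d → Fin n)

variable {d n : ℕ}

/-- The elementary tensor `u_1 ⊗ ⋯ ⊗ u_d`. -/
def elementary (u : Fin d → EuclideanSpace ℝ (Fin n)) : Tensor d n :=
  WithLp.toLp 2 (fun i => ∏ k, u k (i k))

/-- `A` has (real tensor) rank at most `r`: it is a sum of `r` elementary tensors, some of which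
may be zero. The elementary tensors need not be symmetric. -/
def RankLE (r : ℕ) (A : Tensor d n) : Prop :=
  ∃ u : Fin r → Fin d → EuclideanSpace ℝ (Fin n), A = ∑ j, elementary (u j)

/-- `A` is symmetric: its entries are invariant under permutations of the `d` indices. -/
def IsSymmetric (A : Tensor d n) : Prop :=
  ∀ (σ : Equiv.Perm (Fin d)) (i : Fin d → Fin n), A (fun k => i (σ k)) = A i

/-- `m = min_{rank B ≤ 1} ‖A - B‖_F / ‖A‖_F`, the minimum being attained
(meaningful for `A ≠ 0`). -/
def IsRelDist (A : Tensor d n) (m : ℝ) : Prop :=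
  IsLeast {r : ℝ | ∃ B : Tensor d n, RankLE 1 B ∧ r = ‖A - B‖ / ‖A‖} m

/-- The symmetric power `u^d = u ⊗ ⋯ ⊗ u`. -/
def symPow (d : ℕ) (u : EuclideanSpace ℝ (Fin n)) : Tensor d n := elementary (fun _ => u)

/-- The symmetric product `u_1 u_2 ⋯ u_d`, the symmetrization of `u_1 ⊗ ⋯ ⊗ u_d`. -/
def symProd (u : Fin d → EuclideanSpace ℝ (Fin n)) : Tensor d n :=
  (1 / (d.factorial : ℝ)) • ∑ σ : Equiv.Perm (Fin d), elementary (fun k => u (σ k))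

/-- The first standard basis vector of `ℝ^n`, `n ≥ 2`. -/
def e₁ (hn : 2 ≤ n) : EuclideanSpace ℝ (Fin n) := EuclideanSpace.single ⟨0, by omega⟩ 1

/-- The second standard basis vector of `ℝ^n`, `n ≥ 2`. -/
def e₂ (hn : 2 ≤ n) : EuclideanSpace ℝ (Fin n) := EuclideanSpace.single ⟨1, by omega⟩ 1

/-- The tensor `W_d = d e_1^{d-1} e_2`. -/
def W (d : ℕ) (hn : 2 ≤ n) : Tensor d n :=
  (d : ℝ) • symProd (fun k : Fin d => if (k : ℕ) + 1 = d then e₂ hn else e₁ hn)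

end RealTensor

end

/-!
Write `K = (1 - 1/d)^(d-1)`. Minimising over the scale of an elementary tensor shows that the
relative distance of `A` to the tensors of rank at most one is `√(1 - σ² / ‖A‖²)`, where `σ` is
the maximum of `⟨A, u₁ ⊗ ⋯ ⊗ u_d⟩` over vectors in the unit ball (`isRelDist_of_forall_inner_le`;
the maximum exists by compactness, `exists_inner_le`). So the bound says `σ² > K ‖A‖²`, and `W_d`
is to satisfy `σ² = K ‖W_d‖²`.

*Reduction to two powers.* If a symmetric tensor `⊗ x_k + ⊗ y_k` has a position `l` with `x_l`,
`y_l` independent, contracting that position with a vector orthogonal to `y_l` leaves a symmetric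
multiple of `⊗_{k ≠ l} x_k`, so the remaining `x_k` are parallel. Two such positions and `d ≥ 3`
make all `x_k` parallel and all `y_k` parallel; with at most one such position the rank is at most
one (`rankLE_one_or_eq_symPow_add`).

*Two powers.* Let `A = α u^d + β v^d` with unit vectors, `⟨u, v⟩ ≥ 0` and `|β| ≤ α`. If `β ≥ 0`,
or if `u ⊥ v`, testing with `u^d` gives `σ² ≥ ‖A‖² / 2`, and `K < 1/2`; if `u = v`, the rank
is one. Otherwise normalise to `A = u^d - t v^d` with `0 < t ≤ 1` and test with a critical
point `w` of `w ↦ ⟨A, w^d⟩` on the circle, lying on the side of `u` away from `v` (`exists_angle_lt`). If `0 < a < b`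
are the tangents of the angles of `u` and `v` with `w`, criticality says that `A` is proportional
to `b (1, a)^d - a (1, b)^d`, and the claim becomes `K N(a, b) < (b - a)²` where `N` is the
squared norm (`pairNormSq_lt`). The quotient `N(a, b) / (b - a)²` is `1` plus a polynomial with
nonnegative coefficients (`pairNormSq_eq`), so it increases with `b`, and `b` may be increased
until `t = 1`. The curve `t = 1` is parametrised by hyperbolic functions (`pairNormSq_lt_of_eq`),
and there the claim is an inequality in one variable `s > 0`, which holds because a certain
quotient is strictly increasing in `s` and has the right limit at `0`
(`mul_sinh_pow_mul_cosh_pow_sub_lt`). The limit `s → 0` is the degeneration of `u^d - v^d` to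
`W_d`.

*The tensor `W_d`.* Pairing `W_d` with `⊗ u_k` gives `∑_k y_k ∏_{j ≠ k} x_j`, where `(x_k, y_k)`
are the first two coordinates of `u_k`. Its square is at most `d K ∏ (x_k² + y_k²)`
(`sum_mul_prod_erase_sq_le`), a form of the inequality `d^(d-2) (∑ a_k)² ≤ ∏ (a_k² + d - 1)`,
which follows from Bernoulli's inequality and Cauchy–Schwarz. Equality holds
when all `u_k` have first coordinates proportional to `(√(d - 1), 1)`, and `‖W_d‖² = d`.

*Sharpness.* The difference quotients tending to `W_d` are symmetric of rank at most two, and the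
relative distance is lower semicontinuous at nonzero tensors (`le_of_tendsto_of_isRelDist`).
-/

namespace RealTensor

/-! ### Hyperbolic inequalities -/

/-- Strict subadditivity of `tanh`, `tanh (m x) < m tanh x`, with the denominators cleared. -/
theorem sinh_nat_mul_mul_cosh_lt {m : ℕ} (hm : 2 ≤ m) {x : ℝ} (hx : 0 < x) :
    Real.sinh (m * x) * Real.cosh x < m * Real.sinh x * Real.cosh (m * x) := by
  have hs : 0 < Real.sinh x := Real.sinh_pos_iff.2 hx
  have hc := Real.cosh_pos x
  induction m, hm using Nat.le_induction with
  | base =>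
    push_cast
    rw [Real.sinh_two_mul, Real.cosh_two_mul]
    nlinarith [pow_pos hs 3]
  | succ m hm ih =>
    have hS : 0 < Real.sinh (m * x) := Real.sinh_pos_iff.2 (by positivity)
    have hC := Real.cosh_pos (m * x)
    have e : ((m + 1 : ℕ) : ℝ) * x = m * x + x := by push_cast; ring
    rw [e, Real.sinh_add, Real.cosh_add]
    push_cast
    have h1 : Real.cosh x ^ 2 = Real.sinh x ^ 2 + 1 := Real.cosh_sq x
    have h2 : 0 ≤ m * Real.sinh x * (Real.sinh (m * x) * Real.sinh x) := by positivity
    nlinarith [mul_lt_mul_of_pos_right ih hc, mul_pos hS (mul_pos hs hs)]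

/-- The logarithms of the two sides agree at `s = 0`, and the difference of their derivatives is
positive by `tanh (2ms) < m tanh (2s)`. -/
theorem cosh_mul_cosh_pow_lt {m : ℕ} (hm : 2 ≤ m) {s : ℝ} (hs : 0 < s) :
    Real.cosh (2 * m * s) * Real.cosh ((m - 1) * s) ^ m < Real.cosh ((m + 1) * s) ^ m := by
  let f : ℝ → ℝ := fun s => m * Real.log (Real.cosh ((m + 1) * s))
    - m * Real.log (Real.cosh ((m - 1) * s)) - Real.log (Real.cosh (2 * m * s))
  have hd : ∀ s, HasDerivAt f (m * (Real.sinh ((m + 1) * s) * (m + 1) / Real.cosh ((m + 1) * s))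
      - m * (Real.sinh ((m - 1) * s) * (m - 1) / Real.cosh ((m - 1) * s))
      - Real.sinh (2 * m * s) * (2 * m) / Real.cosh (2 * m * s)) s := by
    intro s
    have key : ∀ c : ℝ, HasDerivAt (fun s => Real.log (Real.cosh (c * s)))
        (Real.sinh (c * s) * c / Real.cosh (c * s)) s := fun c =>
      (((hasDerivAt_id s).const_mul c).congr_deriv (mul_one c)).cosh.log (Real.cosh_pos _).ne'
    exact (((key _).const_mul _).sub ((key _).const_mul _)).sub (key _)
  have hm1 : (1 : ℝ) ≤ m := by exact_mod_cast (by omega : 1 ≤ m)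
  have hmono : StrictMonoOn f (Set.Ici 0) := by
    refine strictMonoOn_of_deriv_pos (convex_Ici 0)
      (fun x _ => (hd x).continuousAt.continuousWithinAt) ?_
    intro x hx
    rw [interior_Ici] at hx
    have hx : 0 < x := hx
    rw [(hd x).deriv]
    set A := Real.cosh ((m + 1) * x) with hA
    set B := Real.cosh ((m - 1) * x) with hB
    set A' := Real.sinh ((m + 1) * x) with hA'
    set B' := Real.sinh ((m - 1) * x) with hB'
    have e1 : Real.sinh (2 * m * x) = A' * B + A * B' := by
      rw [show 2 * m * x = (m + 1) * x + (m - 1) * x by ring, Real.sinh_add]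
    have e2 : Real.cosh (2 * m * x) = A * B + A' * B' := by
      rw [show 2 * m * x = (m + 1) * x + (m - 1) * x by ring, Real.cosh_add]
    have e3 : Real.sinh (2 * x) = A' * B - A * B' := by
      rw [show 2 * x = (m + 1) * x - (m - 1) * x by ring, Real.sinh_sub]
    have e4 : Real.cosh (2 * x) = A * B - A' * B' := by
      rw [show 2 * x = (m + 1) * x - (m - 1) * x by ring, Real.cosh_sub]
    have k := sinh_nat_mul_mul_cosh_lt hm (x := 2 * x) (by positivity)
    rw [show (m : ℝ) * (2 * x) = 2 * m * x by ring, e1, e2, e3, e4] at k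
    have pA : 0 < A := Real.cosh_pos _
    have pB : 0 < B := Real.cosh_pos _
    have pE : 0 < A * B + A' * B' := e2 ▸ Real.cosh_pos _
    rw [e1, e2]
    have : m * (A' * (m + 1) / A) - m * (B' * (m - 1) / B)
        - (A' * B + A * B') * (2 * m) / (A * B + A' * B')
        = m * (m * (A' * B - A * B') * (A * B + A' * B')
          - (A' * B + A * B') * (A * B - A' * B')) / (A * B * (A * B + A' * B')) := by
      field_simp
      ring
    rw [this]
    have : 0 < m * (A' * B - A * B') * (A * B + A' * B')
          - (A' * B + A * B') * (A * B - A' * B') := by linarith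
    positivity
  have h0 : f 0 = 0 := by simp [f]
  have h := hmono Set.self_mem_Ici (Set.mem_Ici.2 hs.le) hs
  rw [h0] at h
  have pa := Real.cosh_pos ((m + 1) * s)
  have pb := Real.cosh_pos ((m - 1) * s)
  have pc := Real.cosh_pos (2 * m * s)
  rw [← Real.log_lt_log_iff (by positivity) (by positivity), Real.log_mul pc.ne' (by positivity),
    Real.log_pow, Real.log_pow]
  simp only [f] at h
  linarith

/-- This is the logarithm of the quotient whose lower bound `mul_sinh_pow_mul_cosh_pow_sub_lt`
asserts. With `Y = (m + 1)s` and `Z = (m - 1)s` its derivative is a positive multiple of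
`cosh Y ^ m - cosh (Y + Z) * cosh Z ^ m`. -/
theorem strictMonoOn_log_sinh_cosh {m : ℕ} (hm : 2 ≤ m) :
    StrictMonoOn (fun s : ℝ => (m + 1) * Real.log (Real.sinh (2 * m * s))
      - (m - 1) * Real.log (Real.sinh ((m + 1) * s))
      - Real.log (Real.cosh ((m + 1) * s) ^ (m + 1) - Real.cosh ((m - 1) * s) ^ (m + 1)))
      (Set.Ioi 0) := by
  have hm1 : (1 : ℝ) ≤ m := by exact_mod_cast (by omega : 1 ≤ m)
  have hpos : ∀ s : ℝ, 0 < s →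
      0 < Real.cosh ((m + 1) * s) ^ (m + 1) - Real.cosh ((m - 1) * s) ^ (m + 1) := by
    intro s hs
    have : Real.cosh ((m - 1) * s) < Real.cosh ((m + 1) * s) := by
      rw [Real.cosh_lt_cosh, abs_of_nonneg (by nlinarith), abs_of_nonneg (by positivity)]
      nlinarith
    have := pow_lt_pow_left₀ this (Real.cosh_pos _).le (Nat.succ_ne_zero m)
    simpa using sub_pos.2 this
  have hd : ∀ s : ℝ, 0 < s → HasDerivAt (fun s : ℝ => (m + 1) * Real.log (Real.sinh (2 * m * s))
      - (m - 1) * Real.log (Real.sinh ((m + 1) * s))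
      - Real.log (Real.cosh ((m + 1) * s) ^ (m + 1) - Real.cosh ((m - 1) * s) ^ (m + 1)))
      ((m + 1) * (Real.cosh (2 * m * s) * (2 * m) / Real.sinh (2 * m * s))
      - (m - 1) * (Real.cosh ((m + 1) * s) * (m + 1) / Real.sinh ((m + 1) * s))
      - ((m + 1) * Real.cosh ((m + 1) * s) ^ m * (Real.sinh ((m + 1) * s) * (m + 1))
        - (m + 1) * Real.cosh ((m - 1) * s) ^ m * (Real.sinh ((m - 1) * s) * (m - 1)))
        / (Real.cosh ((m + 1) * s) ^ (m + 1) - Real.cosh ((m - 1) * s) ^ (m + 1))) s := by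
    intro s hs
    have lin : ∀ c : ℝ, HasDerivAt (fun s => c * s) c s := fun c =>
      ((hasDerivAt_id s).const_mul c).congr_deriv (mul_one c)
    have k1 : ∀ c : ℝ, 0 < c → HasDerivAt (fun s => Real.log (Real.sinh (c * s)))
        (Real.cosh (c * s) * c / Real.sinh (c * s)) s := fun c hc =>
      (lin c).sinh.log (Real.sinh_pos_iff.2 (by positivity)).ne'
    have k2 : ∀ c : ℝ, HasDerivAt (fun s => Real.cosh (c * s) ^ (m + 1))
        ((m + 1) * Real.cosh (c * s) ^ m * (Real.sinh (c * s) * c)) s := fun c => 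
      ((lin c).cosh.fun_pow (m + 1)).congr_deriv (by simp)
    exact (((k1 _ (by positivity)).const_mul _).sub ((k1 _ (by positivity)).const_mul _)).sub
      (((k2 _).sub (k2 _)).log (hpos s hs).ne')
  refine strictMonoOn_of_deriv_pos (convex_Ioi 0)
    (fun x hx => (hd x hx).continuousAt.continuousWithinAt) ?_
  intro s hs
  rw [interior_Ioi] at hs
  have hs : 0 < s := hs
  rw [(hd s hs).deriv]
  have hΦ := hpos s hs
  have hM := cosh_mul_cosh_pow_lt hm hs
  have e1 : Real.sinh (2 * m * s) = Real.sinh ((m + 1) * s) * Real.cosh ((m - 1) * s)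
      + Real.cosh ((m + 1) * s) * Real.sinh ((m - 1) * s) := by
    rw [show 2 * m * s = (m + 1) * s + (m - 1) * s by ring, Real.sinh_add]
  have e2 : Real.cosh (2 * m * s) = Real.cosh ((m + 1) * s) * Real.cosh ((m - 1) * s)
      + Real.sinh ((m + 1) * s) * Real.sinh ((m - 1) * s) := by
    rw [show 2 * m * s = (m + 1) * s + (m - 1) * s by ring, Real.cosh_add]
  have e3 : Real.sinh (2 * s) = Real.sinh ((m + 1) * s) * Real.cosh ((m - 1) * s)
      - Real.cosh ((m + 1) * s) * Real.sinh ((m - 1) * s) := by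
    rw [show 2 * s = (m + 1) * s - (m - 1) * s by ring, Real.sinh_sub]
  have p1 : 0 < Real.sinh (2 * m * s) := Real.sinh_pos_iff.2 (by positivity)
  have p2 : 0 < Real.sinh (2 * s) := Real.sinh_pos_iff.2 (by positivity)
  have p3 : 0 < Real.sinh ((m + 1) * s) := Real.sinh_pos_iff.2 (by positivity)
  have sA := Real.cosh_sq ((m + 1) * s)
  rw [e2] at hM ⊢
  rw [pow_succ, pow_succ] at hΦ ⊢
  generalize hE : Real.sinh (2 * m * s) = E at *
  generalize hF : Real.sinh (2 * s) = F at *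
  generalize Real.cosh ((m + 1) * s) = A at *
  generalize Real.cosh ((m - 1) * s) = B at *
  generalize Real.sinh ((m + 1) * s) = A' at *
  generalize Real.sinh ((m - 1) * s) = B' at *
  generalize A ^ m = P at *
  generalize B ^ m = Q at *
  have : (m + 1) * ((A * B + A' * B') * (2 * m) / E) - (m - 1) * (A * (m + 1) / A')
      - ((m + 1) * P * (A' * (m + 1)) - (m + 1) * Q * (B' * (m - 1))) / (P * A - Q * B)
      = (m + 1) * (m * F + E) * (P - (A * B + A' * B') * Q) / (E * A' * (P * A - Q * B)) := by
    have hne := hΦ.ne'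
    rw [mul_div_assoc', mul_div_assoc', div_sub_div _ _ p1.ne' p3.ne',
      div_sub_div _ _ (by positivity) hne]
    congr 1
    rw [e1, e3]
    linear_combination (m + 1) * P * (m * (A' * B - A * B') + (A' * B + A * B')) * sA
  rw [this]
  have : 0 < P - (A * B + A' * B') * Q := by linarith
  positivity


theorem tendsto_sinh_mul_div (c : ℝ) :
    Tendsto (fun s : ℝ => Real.sinh (c * s) / s) (𝓝[>] 0) (𝓝 c) := by
  have h : HasDerivAt (fun s : ℝ => Real.sinh (c * s)) c 0 := by
    have := ((hasDerivAt_id (0 : ℝ)).const_mul c).sinh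
    simpa using this
  have := h.tendsto_slope.mono_left (nhdsWithin_mono 0 (fun x (hx : 0 < x) => hx.ne'))
  refine this.congr fun s => ?_
  simp [slope_def_field]

/-- The quotient of the right-hand side by the second factor of the left-hand side is strictly
increasing in `s` and tends to `(2m / (m + 1)) ^ m` as `s → 0`. -/
theorem mul_sinh_pow_mul_cosh_pow_sub_lt {m : ℕ} (hm : 2 ≤ m) {s : ℝ} (hs : 0 < s) :
    (2 * (m / (m + 1))) ^ m * (Real.sinh ((m + 1) * s) ^ (m - 1) *
      (Real.cosh ((m + 1) * s) ^ (m + 1) - Real.cosh ((m - 1) * s) ^ (m + 1)))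
      < Real.sinh (2 * m * s) ^ (m + 1) := by
  have hm1 : (1 : ℝ) ≤ m := by exact_mod_cast (by omega : 1 ≤ m)
  have hlow : ∀ s : ℝ, 0 < s → 0 < Real.sinh ((m + 1) * s) ^ (m - 1) *
      (Real.cosh ((m + 1) * s) ^ (m + 1) - Real.cosh ((m - 1) * s) ^ (m + 1)) := by
    intro s hs
    have : Real.cosh ((m - 1) * s) < Real.cosh ((m + 1) * s) := by
      rw [Real.cosh_lt_cosh, abs_of_nonneg (by nlinarith), abs_of_nonneg (by positivity)]
      nlinarith
    have := pow_lt_pow_left₀ this (Real.cosh_pos _).le (Nat.succ_ne_zero m)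
    have h2 : 0 < Real.sinh ((m + 1) * s) := Real.sinh_pos_iff.2 (by positivity)
    exact mul_pos (by positivity) (by simpa using sub_pos.2 this)
  let ρ : ℝ → ℝ := fun s => Real.sinh (2 * m * s) ^ (m + 1) / (Real.sinh ((m + 1) * s) ^ (m - 1) *
      (Real.cosh ((m + 1) * s) ^ (m + 1) - Real.cosh ((m - 1) * s) ^ (m + 1)))
  have hmono : StrictMonoOn ρ (Set.Ioi 0) := by
    intro x hx y hy hxy
    have pos : ∀ s : ℝ, 0 < s → 0 < ρ s := fun s hs => by
      have h1 : 0 < Real.sinh (2 * m * s) := Real.sinh_pos_iff.2 (by positivity)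
      exact div_pos (by positivity) (hlow s hs)
    have hlog : ∀ s : ℝ, 0 < s → Real.log (ρ s) = (m + 1) * Real.log (Real.sinh (2 * m * s))
      - (m - 1) * Real.log (Real.sinh ((m + 1) * s))
      - Real.log (Real.cosh ((m + 1) * s) ^ (m + 1) - Real.cosh ((m - 1) * s) ^ (m + 1)) := by
      intro s hs
      have h1 : 0 < Real.sinh (2 * m * s) := Real.sinh_pos_iff.2 (by positivity)
      have h2 : 0 < Real.sinh ((m + 1) * s) := Real.sinh_pos_iff.2 (by positivity)
      have h3 := hlow s hs
      have h4 := (mul_pos_iff_of_pos_left (by positivity)).1 h3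
      simp only [ρ]
      rw [Real.log_div (by positivity) h3.ne', Real.log_mul (by positivity) h4.ne', Real.log_pow,
        Real.log_pow, Nat.cast_sub (by omega)]
      push_cast
      ring
    rw [← Real.log_lt_log_iff (pos x hx) (pos y hy), hlog x hx, hlog y hy]
    exact strictMonoOn_log_sinh_cosh hm hx hy hxy
  have hlim : Tendsto ρ (𝓝[>] 0) (𝓝 ((2 * (m / (m + 1))) ^ m)) := by
    have hc : Tendsto (fun s : ℝ => ∑ i ∈ Finset.range (m + 1), Real.cosh ((m + 1) * s) ^ i *
        Real.cosh ((m - 1) * s) ^ (m + 1 - 1 - i)) (𝓝[>] 0) (𝓝 (m + 1)) := by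
      have : Continuous (fun s : ℝ => ∑ i ∈ Finset.range (m + 1), Real.cosh ((m + 1) * s) ^ i *
        Real.cosh ((m - 1) * s) ^ (m + 1 - 1 - i)) := by fun_prop
      have := (this.tendsto 0).mono_left (nhdsWithin_le_nhds (s := Set.Ioi 0))
      simpa using this
    -- Numerator and denominator both vanish to order `m + 1`; divide each by `s ^ (m + 1)`.
    have h := ((tendsto_sinh_mul_div (2 * m)).pow (m + 1)).div
      (((tendsto_sinh_mul_div (m + 1)).pow (m - 1)).mul
        ((((tendsto_sinh_mul_div m).mul (tendsto_sinh_mul_div 1)).const_mul 2).mul hc))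
      (by positivity)
    have e : (2 * (m : ℝ)) ^ (m + 1) / (((m : ℝ) + 1) ^ (m - 1) * (2 * (m * 1) * (m + 1)))
        = (2 * (m / (m + 1))) ^ m := by
      obtain ⟨k, rfl⟩ : ∃ k, m = k + 1 := ⟨m - 1, by omega⟩
      simp only [Nat.add_sub_cancel]
      rw [← mul_div_assoc, div_pow]
      field_simp
      ring
    rw [e] at h
    refine h.congr' ?_
    filter_upwards [self_mem_nhdsWithin] with s (hs : 0 < s)
    have e1 : Real.cosh ((m + 1) * s) ^ (m + 1) - Real.cosh ((m - 1) * s) ^ (m + 1)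
        = 2 * (Real.sinh (m * s) * Real.sinh (1 * s)) *
        ∑ i ∈ Finset.range (m + 1), Real.cosh ((m + 1) * s) ^ i *
        Real.cosh ((m - 1) * s) ^ (m + 1 - 1 - i) := by
      rw [← geom_sum₂_mul, mul_comm]
      congr 1
      rw [show ((m : ℝ) + 1) * s = m * s + 1 * s by ring,
        show ((m : ℝ) - 1) * s = m * s - 1 * s by ring, Real.cosh_add, Real.cosh_sub]
      ring
    simp only [ρ, Pi.div_apply]
    rw [e1]
    obtain ⟨k, rfl⟩ : ∃ k, m = k + 1 := ⟨m - 1, by omega⟩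
    simp only [Nat.add_sub_cancel, div_pow]
    field_simp
    ring
  have h1 : (2 * (m / (m + 1)) : ℝ) ^ m ≤ ρ (s / 2) := by
    refine le_of_tendsto hlim ?_
    filter_upwards [Ioo_mem_nhdsGT (half_pos hs)] with x hx
    exact (hmono hx.1 (half_pos hs) hx.2).le
  have h2 := h1.trans_lt (hmono (half_pos hs) hs (half_lt_self hs))
  rwa [lt_div_iff₀ (hlow s hs)] at h2

/-! ### The norm of a pair of powers seen from a critical point -/

/-- The squared Frobenius norm of `b • (1, a)^d - a • (1, b)^d`, written out. -/
def pairNormSq (d : ℕ) (a b : ℝ) : ℝ :=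
  b ^ 2 * (1 + a ^ 2) ^ d + a ^ 2 * (1 + b ^ 2) ^ d - 2 * (a * b) * (1 + a * b) ^ d

/-- The excess over `1` of `pairNormSq d a b / (b - a) ^ 2`, as a polynomial with nonnegative
coefficients. The natural subtraction `k - 1 - i` only occurs for `i < k`. -/
def pairExcess (d : ℕ) (a b : ℝ) : ℝ :=
  ∑ k ∈ Finset.range d, (d.choose (k + 1) : ℝ) *
    (a * b * ∑ i ∈ Finset.range k, a ^ i * b ^ (k - 1 - i)) ^ 2

/-- The entries of `b • (1, a)^d - a • (1, b)^d` are `b a^k - a b^k`, each divisible by `b - a`. -/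
theorem pairNormSq_eq (d : ℕ) (a b : ℝ) :
    pairNormSq d a b = (b - a) ^ 2 * (1 + pairExcess d a b) := by
  have hbin : ∀ x : ℝ, (1 + x) ^ d = ∑ k ∈ Finset.range (d + 1), (d.choose k : ℝ) * x ^ k := by
    intro x
    rw [add_comm, add_pow]
    exact Finset.sum_congr rfl fun k _ => by rw [one_pow]; ring
  have h1 : pairNormSq d a b =
      ∑ k ∈ Finset.range (d + 1), (d.choose k : ℝ) * (b * a ^ k - a * b ^ k) ^ 2 := by
    rw [pairNormSq, hbin, hbin, hbin, Finset.mul_sum, Finset.mul_sum, Finset.mul_sum,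
      ← Finset.sum_add_distrib, ← Finset.sum_sub_distrib]
    exact Finset.sum_congr rfl fun k _ => by ring
  rw [h1, Finset.sum_range_succ', pairExcess, mul_add, mul_one, Finset.mul_sum, add_comm]
  congr 1
  · simp
  · refine Finset.sum_congr rfl fun k _ => ?_
    have := geom_sum₂_mul a b k
    have e : b * a ^ (k + 1) - a * b ^ (k + 1) = a * b * (a ^ k - b ^ k) := by ring
    rw [e, ← this]
    ring

theorem pairExcess_mono {d : ℕ} {a b b' : ℝ} (ha : 0 ≤ a) (hb : 0 ≤ b) (h : b ≤ b') :
    pairExcess d a b ≤ pairExcess d a b' := by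
  have hb' : 0 ≤ b' := hb.trans h
  have : 0 ≤ a * b' := mul_nonneg ha hb'
  unfold pairExcess
  gcongr

/-- The case in which the two powers have equal norm. The solutions of `h` are parametrised by
`s = log (b / a) / (2d)`: with `Y = ds` one has `a b = sinh 2s / sinh (2(d - 1)s)` and
`b / a = exp 2Y`, and the claim becomes `mul_sinh_pow_mul_cosh_pow_sub_lt`. -/
theorem pairNormSq_lt_of_eq {d : ℕ} (hd : 3 ≤ d) {a b : ℝ} (ha : 0 < a) (hab : a < b)
    (h : b ^ 2 * (1 + a ^ 2) ^ d = a ^ 2 * (1 + b ^ 2) ^ d) :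
    (1 - 1 / (d : ℝ)) ^ (d - 1) * pairNormSq d a b < (b - a) ^ 2 := by
  obtain ⟨m, rfl⟩ : ∃ m, d = m + 1 := ⟨d - 1, by omega⟩
  have hm : 2 ≤ m := by omega
  have hm1 : (2 : ℝ) ≤ m := by exact_mod_cast hm
  have hb : 0 < b := ha.trans hab
  set s : ℝ := Real.log (b / a) / (2 * (m + 1)) with hs_def
  have hs : 0 < s := div_pos (Real.log_pos ((one_lt_div ha).2 hab)) (by positivity)
  -- `b / a = exp (2Y)`
  set Y : ℝ := (m + 1) * s with hY
  have hY0 : 0 < Y := by positivity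
  have hba : b = a * Real.exp Y ^ 2 := by
    rw [← Real.exp_nat_mul, hY, hs_def]
    rw [show ((2 : ℕ) : ℝ) * ((m + 1) * (Real.log (b / a) / (2 * (m + 1)))) = Real.log (b / a) by
      push_cast; field_simp, Real.exp_log (by positivity)]
    field_simp
  have hYs : Real.exp Y = Real.exp s ^ (m + 1) := by
    rw [← Real.exp_nat_mul, hY]; push_cast; rfl
  have h1 : 1 + b ^ 2 = Real.exp s ^ 4 * (1 + a ^ 2) := by
    have : (1 + b ^ 2) ^ (m + 1) = (Real.exp s ^ 4 * (1 + a ^ 2)) ^ (m + 1) := by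
      rw [mul_pow, ← pow_mul, mul_comm 4, pow_mul, ← hYs]
      have : a ^ 2 * (1 + b ^ 2) ^ (m + 1)
          = a ^ 2 * (Real.exp Y ^ 4 * (1 + a ^ 2) ^ (m + 1)) := by
        rw [← h, hba]; ring
      exact mul_left_cancel₀ (by positivity) this
    exact (pow_left_inj₀ (by positivity) (by positivity) (Nat.succ_ne_zero m)).1 this
  set S : ℝ := Real.sinh (2 * m * s) with hS
  have hS0 : 0 < S := Real.sinh_pos_iff.2 (by positivity)
  have hSY : 0 < Real.sinh Y := Real.sinh_pos_iff.2 hY0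
  have hg := Real.exp_pos s
  have hG := Real.exp_pos Y
  have hSexp : S = (Real.exp Y ^ 4 - Real.exp s ^ 4) / (2 * Real.exp s ^ 2 * Real.exp Y ^ 2) := by
    rw [hS, show 2 * m * s = (Y + Y) - (s + s) by rw [hY]; ring, Real.sinh_eq, neg_sub,
      Real.exp_sub, Real.exp_sub, Real.exp_add, Real.exp_add]
    field_simp
  have haG : a ^ 2 * (Real.exp Y ^ 4 - Real.exp s ^ 4) = Real.exp s ^ 4 - 1 := by
    rw [hba] at h1
    linear_combination h1
  have hp : a * b * S = Real.sinh (2 * s) := by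
    rw [hSexp, hba, Real.sinh_eq, two_mul s, Real.exp_neg, Real.exp_add]
    field_simp
    linear_combination haG
  have hp1 : 1 + a * b = 2 * Real.sinh Y * Real.cosh ((m - 1) * s) / S := by
    rw [eq_div_iff hS0.ne', add_mul, hp, hS, show 2 * m * s = Y + (m - 1) * s by rw [hY]; ring,
      show 2 * s = Y - (m - 1) * s by rw [hY]; ring, Real.sinh_add, Real.sinh_sub]
    ring
  have ha1 : Real.exp s ^ 2 * (1 + a ^ 2) = 2 * Real.sinh Y * Real.cosh Y / S := by
    rw [eq_div_iff hS0.ne', ← Real.sinh_two_mul, hSexp, Real.sinh_eq, two_mul Y, Real.exp_neg,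
      Real.exp_add]
    field_simp
    linear_combination haG
  have hD : b ^ 2 * (1 + a ^ 2) ^ (m + 1)
      = a * b * (2 * Real.sinh Y * Real.cosh Y / S) ^ (m + 1) := by
    rw [← ha1, mul_pow, ← pow_mul, mul_comm 2, pow_mul, ← hYs, hba]
    ring
  have hN : pairNormSq (m + 1) a b = 2 * (a * b) * ((2 * Real.sinh Y / S) ^ (m + 1) *
      (Real.cosh Y ^ (m + 1) - Real.cosh ((m - 1) * s) ^ (m + 1))) := by
    rw [pairNormSq, ← h, hD, hp1]
    ring
  have hr : (b - a) ^ 2 = 4 * (a * b) * Real.sinh Y ^ 2 := by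
    rw [hba, Real.sinh_eq, Real.exp_neg]
    field_simp
    ring
  have key := mul_sinh_pow_mul_cosh_pow_sub_lt hm hs
  rw [← hY, ← hS] at key
  have hκ : 1 - 1 / ((m + 1 : ℕ) : ℝ) = m / (m + 1) := by push_cast; field_simp; ring
  rw [hN, hr, hκ, Nat.add_sub_cancel]
  set Φ := Real.cosh Y ^ (m + 1) - Real.cosh ((m - 1) * s) ^ (m + 1)
  have e : (m / (m + 1) : ℝ) ^ m * (2 * (a * b) * ((2 * Real.sinh Y / S) ^ (m + 1) * Φ))
      = 4 * (a * b) * Real.sinh Y ^ 2 *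
        ((2 * (m / (m + 1))) ^ m * (Real.sinh Y ^ (m - 1) * Φ)) / S ^ (m + 1) := by
    obtain ⟨k, rfl⟩ : ∃ k, m = k + 1 := ⟨m - 1, by omega⟩
    simp only [Nat.add_sub_cancel]
    ring
  rw [e, div_lt_iff₀ (by positivity)]
  exact mul_lt_mul_of_pos_left key (by positivity)

/-- The hypothesis says that `b • (1, a)^d` is at least as long as `a • (1, b)^d`. Raising `b` until
they are equally long only increases `pairNormSq d a b / (b - a) ^ 2`. -/
theorem pairNormSq_lt {d : ℕ} (hd : 3 ≤ d) {a b : ℝ} (ha : 0 < a) (hab : a < b)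
    (h : a ^ 2 * (1 + b ^ 2) ^ d ≤ b ^ 2 * (1 + a ^ 2) ^ d) :
    (1 - 1 / (d : ℝ)) ^ (d - 1) * pairNormSq d a b < (b - a) ^ 2 := by
  have hb : 0 < b := ha.trans hab
  obtain ⟨B, hbB, hB⟩ : ∃ B, b ≤ B ∧ B ^ 2 * (1 + a ^ 2) ^ d = a ^ 2 * (1 + B ^ 2) ^ d := by
    set C := b + (1 + a ^ 2) ^ d / a ^ 2 + 1 with hC
    have hq : 0 < (1 + a ^ 2) ^ d / a ^ 2 := by positivity
    have hbC : b ≤ C := by linarith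
    have hcont : ContinuousOn (fun x : ℝ => a ^ 2 * (1 + x ^ 2) ^ d - x ^ 2 * (1 + a ^ 2) ^ d)
      (Set.Icc b C) := by fun_prop
    have h0 : (0 : ℝ) ∈ Set.Icc (a ^ 2 * (1 + b ^ 2) ^ d - b ^ 2 * (1 + a ^ 2) ^ d)
        (a ^ 2 * (1 + C ^ 2) ^ d - C ^ 2 * (1 + a ^ 2) ^ d) := by
      refine ⟨by linarith, ?_⟩
      have h1 : (1 + C ^ 2) ^ 2 ≤ (1 + C ^ 2) ^ d :=
        pow_le_pow_right₀ (by nlinarith) (by omega)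
      have h2 : (1 + a ^ 2) ^ d = a ^ 2 * ((1 + a ^ 2) ^ d / a ^ 2) := by field_simp
      have h3 : (1 + a ^ 2) ^ d / a ^ 2 ≤ C ^ 2 := by nlinarith
      have h4 : C ^ 2 * ((1 + a ^ 2) ^ d / a ^ 2) ≤ (1 + C ^ 2) ^ d := by nlinarith
      rw [h2]
      nlinarith [mul_le_mul_of_nonneg_left h4 (sq_nonneg a)]
    obtain ⟨B, hB, hB0⟩ := intermediate_value_Icc hbC hcont h0
    exact ⟨B, hB.1, by simp only at hB0; linarith⟩
  have key := pairNormSq_lt_of_eq hd ha (hab.trans_le hbB) hB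
  rw [pairNormSq_eq] at key ⊢
  have hK : 0 ≤ (1 - 1 / (d : ℝ)) ^ (d - 1) := by
    have : 1 / (d : ℝ) ≤ 1 := by
      rw [div_le_one (by positivity)]; exact_mod_cast (by omega : 1 ≤ d)
    exact pow_nonneg (by linarith) _
  have h1 : 0 < (B - a) ^ 2 := by have := hab.trans_le hbB; exact pow_pos (by linarith) 2
  have h2 : 0 < (b - a) ^ 2 := pow_pos (by linarith) 2
  have h3 : (1 - 1 / (d : ℝ)) ^ (d - 1) * (1 + pairExcess d a B) < 1 := by
    by_contra! hc
    nlinarith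
  have h4 := mul_le_mul_of_nonneg_left (pairExcess_mono (d := d) ha.le hb.le hbB) hK
  nlinarith

/-- For unit vectors `u`, `v` at angle `δ`, this bounds `⟨u^d - t v^d, w^d⟩ ^ 2` from below by
`(1 - 1/d)^(d-1) * ‖u^d - t v^d‖ ^ 2` for some unit vector `w`, at angle `η` to `u` and `η + δ` to
`v`. -/
theorem exists_angle_lt {d : ℕ} (hd : 3 ≤ d) {δ t : ℝ} (hδ : 0 < δ) (hδ' : δ < Real.pi / 2)
    (ht : 0 < t) (ht1 : t ≤ 1) :
    ∃ η, (1 - 1 / (d : ℝ)) ^ (d - 1) * (1 + t ^ 2 - 2 * t * Real.cos δ ^ d) <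
      (Real.cos η ^ d - t * Real.cos (η + δ) ^ d) ^ 2 := by
  obtain ⟨m, rfl⟩ : ∃ m, d = m + 1 := ⟨d - 1, by omega⟩
  have hm : m ≠ 0 := by omega
  -- `η` is a critical point of `cos η ^ d - t * cos (η + δ) ^ d`.
  obtain ⟨η, ⟨h0, h1⟩, hη⟩ : ∃ η ∈ Set.Ioo 0 (Real.pi / 2 - δ),
      Real.sin η * Real.cos η ^ m - t * (Real.sin (η + δ) * Real.cos (η + δ) ^ m) = 0 := by
    have hcont : ContinuousOn (fun η : ℝ => Real.sin η * Real.cos η ^ m -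
        t * (Real.sin (η + δ) * Real.cos (η + δ) ^ m)) (Set.Icc 0 (Real.pi / 2 - δ)) := by fun_prop
    refine intermediate_value_Ioo (by linarith) hcont ⟨?_, ?_⟩
    · have h1 : 0 < Real.sin δ := Real.sin_pos_of_pos_of_lt_pi hδ (by linarith)
      have h2 : 0 < Real.cos δ := Real.cos_pos_of_mem_Ioo ⟨by linarith, hδ'⟩
      simp only [Real.sin_zero, zero_add, zero_mul, zero_sub, neg_lt_zero]
      positivity
    · have h1 : 0 < Real.sin (Real.pi / 2 - δ) :=
        Real.sin_pos_of_pos_of_lt_pi (by linarith) (by linarith)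
      have h2 : 0 < Real.cos (Real.pi / 2 - δ) :=
        Real.cos_pos_of_mem_Ioo ⟨by linarith, by linarith⟩
      simp only [sub_add_cancel, Real.cos_pi_div_two, zero_pow hm, mul_zero, sub_zero]
      positivity
  refine ⟨η, ?_⟩
  have s1 : 0 < Real.sin η := Real.sin_pos_of_pos_of_lt_pi h0 (by linarith)
  have c1 : 0 < Real.cos η := Real.cos_pos_of_mem_Ioo ⟨by linarith, by linarith⟩
  have s2 : 0 < Real.sin (η + δ) := Real.sin_pos_of_pos_of_lt_pi (by linarith) (by linarith)
  have c2 : 0 < Real.cos (η + δ) := Real.cos_pos_of_mem_Ioo ⟨by linarith, by linarith⟩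
  have hcδ : Real.cos δ = Real.cos η * Real.cos (η + δ) + Real.sin η * Real.sin (η + δ) := by
    rw [show δ = (η + δ) - η by ring, Real.cos_sub]; ring_nf
  have hab : Real.sin η / Real.cos η < Real.sin (η + δ) / Real.cos (η + δ) := by
    rw [← Real.tan_eq_sin_div_cos, ← Real.tan_eq_sin_div_cos]
    exact Real.tan_lt_tan_of_nonneg_of_lt_pi_div_two h0.le (by linarith) (by linarith)
  have q1 := Real.sin_sq_add_cos_sq η
  have q2 := Real.sin_sq_add_cos_sq (η + δ)
  generalize Real.sin η = x at *
  generalize Real.cos η = p at *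
  generalize Real.sin (η + δ) = y at *
  generalize Real.cos (η + δ) = q at *
  have ea : 1 + (x / p) ^ 2 = (1 / p) ^ 2 := by field_simp; linarith
  have eb : 1 + (y / q) ^ 2 = (1 / q) ^ 2 := by field_simp; linarith
  have et : x / p * p ^ (m + 1) = t * (y / q * q ^ (m + 1)) := by
    rw [pow_succ, pow_succ]; field_simp; linarith
  have ec : Real.cos δ = p * q * (1 + x / p * (y / q)) := by rw [hcδ]; field_simp
  set a := x / p
  set b := y / q
  have ha : 0 < a := by positivity
  have hb : 0 < b := by positivity
  have hp : (1 + a ^ 2) ^ (m + 1) = 1 / (p ^ (m + 1)) ^ 2 := by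
    rw [ea, ← pow_mul, mul_comm, pow_mul, one_div_pow, one_div_pow]
  have hq : (1 + b ^ 2) ^ (m + 1) = 1 / (q ^ (m + 1)) ^ 2 := by
    rw [eb, ← pow_mul, mul_comm, pow_mul, one_div_pow, one_div_pow]
  have hP : 0 < p ^ (m + 1) := by positivity
  have hQ : 0 < q ^ (m + 1) := by positivity
  have key := pairNormSq_lt hd ha hab (by
    rw [hp, hq, mul_one_div, mul_one_div, div_le_div_iff₀ (by positivity) (by positivity),
      ← mul_pow, ← mul_pow, et]
    apply pow_le_pow_left₀ (by positivity)
    nlinarith [mul_pos hb hQ])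
  rw [pairNormSq, hp, hq] at key
  rw [ec, mul_pow, mul_pow]
  set P := p ^ (m + 1)
  set Q := q ^ (m + 1)
  have ht' : t = a * P / (b * Q) := by field_simp; linarith
  have e1 : (P - t * Q) ^ 2 = (b - a) ^ 2 * (P / b) ^ 2 := by rw [ht']; field_simp
  have e2 : 1 + t ^ 2 - 2 * t * (P * Q * (1 + a * b) ^ (m + 1)) =
      (b ^ 2 * (1 / P ^ 2) + a ^ 2 * (1 / Q ^ 2) - 2 * (a * b) * (1 + a * b) ^ (m + 1))
      * (P / b) ^ 2 := by
    rw [ht']; field_simp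
  rw [e1, e2, ← mul_assoc]
  exact mul_lt_mul_of_pos_right key (by positivity)

theorem two_mul_one_sub_pow_lt {d : ℕ} (hd : 3 ≤ d) :
    2 * (1 - 1 / (d : ℝ)) ^ (d - 1) < 1 := by
  obtain ⟨m, rfl⟩ : ∃ m, d = m + 1 := ⟨d - 1, by omega⟩
  have hm : (2 : ℝ) ≤ m := by exact_mod_cast (by omega : 2 ≤ m)
  have hκ : 1 - 1 / ((m + 1 : ℕ) : ℝ) = (1 + 1 / (m : ℝ))⁻¹ := by push_cast; field_simp; ring
  rw [hκ, Nat.add_sub_cancel, inv_pow, ← div_eq_mul_inv, div_lt_one (by positivity)]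
  have := one_add_mul_self_lt_rpow_one_add (s := 1 / (m : ℝ)) (p := m)
    (by have : 0 < 1 / (m : ℝ) := by positivity
        linarith) (by positivity) (by linarith)
  rw [Real.rpow_natCast, mul_one_div_cancel (by positivity)] at this
  linarith

theorem one_sub_pow_pos {d : ℕ} (hd : 3 ≤ d) : 0 < (1 - 1 / (d : ℝ)) ^ (d - 1) := by
  have hd' : (3 : ℝ) ≤ d := by exact_mod_cast hd
  have : 1 / (d : ℝ) < 1 := by
    rw [div_lt_one (by positivity)]; linarith
  exact pow_pos (by linarith) _

theorem one_le_mul_one_sub_pow {d : ℕ} (hd : 3 ≤ d) :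
    1 ≤ d * (1 - 1 / (d : ℝ)) ^ (d - 1) := by
  have hd' : (3 : ℝ) ≤ d := by exact_mod_cast hd
  have h := one_add_mul_le_pow (a := -(1 / (d : ℝ))) (by
    have : 1 / (d : ℝ) ≤ 1 := by rw [div_le_one (by positivity)]; linarith
    linarith) (d - 1)
  rw [Nat.cast_sub (by omega), ← sub_eq_add_neg] at h
  have : 1 + ((d : ℝ) - (1 : ℕ)) * -(1 / (d : ℝ)) = 1 / d := by push_cast; field_simp; ring
  rw [this, div_le_iff₀ (by positivity)] at h
  linarith

variable {d n : ℕ}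

/-! ### Elementary tensors and the relative distance -/

theorem elementary_apply (u : Fin d → EuclideanSpace ℝ (Fin n)) (i : Fin d → Fin n) :
    elementary u i = ∏ k, u k (i k) := rfl

theorem inner_elementary (u v : Fin d → EuclideanSpace ℝ (Fin n)) :
    inner ℝ (elementary u) (elementary v) = ∏ k, inner ℝ (u k) (v k) := by
  simp only [PiLp.inner_apply, elementary_apply, RCLike.inner_apply, conj_trivial]
  rw [Finset.prod_univ_sum, Fintype.piFinset_univ]
  exact Finset.sum_congr rfl fun i _ => Finset.prod_mul_distrib.symm

theorem norm_elementary (u : Fin d → EuclideanSpace ℝ (Fin n)) :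
    ‖elementary u‖ = ∏ k, ‖u k‖ := by
  rw [← sq_eq_sq₀ (norm_nonneg _) (Finset.prod_nonneg fun _ _ => norm_nonneg _),
    ← real_inner_self_eq_norm_sq, inner_elementary, ← Finset.prod_pow]
  simp only [real_inner_self_eq_norm_sq]

theorem elementary_update_smul (u : Fin d → EuclideanSpace ℝ (Fin n)) (k : Fin d) (c : ℝ)
    (x : EuclideanSpace ℝ (Fin n)) :
    elementary (Function.update u k (c • x)) = c • elementary (Function.update u k x) := by
  ext i
  simp only [PiLp.smul_apply, elementary_apply, smul_eq_mul]
  rw [← Finset.mul_prod_erase _ _ (Finset.mem_univ k),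
    ← Finset.mul_prod_erase _ _ (Finset.mem_univ k)]
  simp only [Function.update_self, PiLp.smul_apply, smul_eq_mul, mul_assoc]
  congr 2
  refine Finset.prod_congr rfl fun j hj => ?_
  rw [Function.update_of_ne (Finset.ne_of_mem_erase hj),
    Function.update_of_ne (Finset.ne_of_mem_erase hj)]

theorem elementary_update_add (u : Fin d → EuclideanSpace ℝ (Fin n)) (k : Fin d)
    (x y : EuclideanSpace ℝ (Fin n)) :
    elementary (Function.update u k (x + y)) =
      elementary (Function.update u k x) + elementary (Function.update u k y) := by
  ext i
  simp only [PiLp.add_apply, elementary_apply]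
  simp only [← Finset.mul_prod_erase _ _ (Finset.mem_univ k), Function.update_self,
    PiLp.add_apply, add_mul]
  congr 2 <;> refine Finset.prod_congr rfl fun j hj => ?_ <;>
  rw [Function.update_of_ne (Finset.ne_of_mem_erase hj),
    Function.update_of_ne (Finset.ne_of_mem_erase hj)]

theorem elementary_smul (c : Fin d → ℝ) (u : Fin d → EuclideanSpace ℝ (Fin n)) :
    elementary (fun k => c k • u k) = (∏ k, c k) • elementary u := by
  ext i
  simp [elementary_apply, Finset.prod_mul_distrib]

theorem smul_elementary (hd : 0 < d) (c : ℝ) (u : Fin d → EuclideanSpace ℝ (Fin n)) :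
    ∃ v, c • elementary u = elementary v :=
  ⟨Function.update u ⟨0, hd⟩ (c • u ⟨0, hd⟩), by
    rw [elementary_update_smul, Function.update_eq_self]⟩

theorem rankLE_one_iff {B : Tensor d n} : RankLE 1 B ↔ ∃ u, B = elementary u := by
  constructor
  · rintro ⟨u, hu⟩
    exact ⟨u 0, by simpa using hu⟩
  · rintro ⟨u, hu⟩
    exact ⟨fun _ => u, by simpa using hu⟩

/-- If `w` maximises `⟨A, ·⟩` over elementary tensors of norm at most one, with value `σ`, then
`σ • elementary w` is a best approximation of rank at most one. -/
theorem isRelDist_of_forall_inner_le (hd : 0 < d) {A : Tensor d n} (hA : A ≠ 0)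
    {w : Fin d → EuclideanSpace ℝ (Fin n)} (hw : ‖elementary w‖ ≤ 1)
    (h : ∀ v, inner ℝ A (elementary v) ≤ inner ℝ A (elementary w) * ‖elementary v‖) :
    IsRelDist A (√(1 - inner ℝ A (elementary w) ^ 2 / ‖A‖ ^ 2)) := by
  have hA' : 0 < ‖A‖ := norm_pos_iff.2 hA
  set σ := inner ℝ A (elementary w)
  have key : ∀ v, ‖A‖ ^ 2 - σ ^ 2 ≤ ‖A - elementary v‖ ^ 2 := by
    intro v
    rw [norm_sub_sq_real]
    nlinarith [h v, sq_nonneg (‖elementary v‖ - σ)]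
  have low : ∀ v, √(1 - σ ^ 2 / ‖A‖ ^ 2) ≤ ‖A - elementary v‖ / ‖A‖ := by
    intro v
    apply Real.sqrt_le_iff.2 ⟨by positivity, ?_⟩
    rw [div_pow, le_div_iff₀ (by positivity), sub_mul, one_mul, div_mul_cancel₀ _ (by positivity)]
    exact key v
  constructor
  · obtain ⟨v, hv⟩ := smul_elementary hd σ w
    refine ⟨elementary v, rankLE_one_iff.2 ⟨v, rfl⟩, le_antisymm (low v) ?_⟩
    apply Real.le_sqrt_of_sq_le
    rw [div_pow, div_le_iff₀ (by positivity), sub_mul, one_mul, div_mul_cancel₀ _ (by positivity),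
      ← hv, norm_sub_sq_real, inner_smul_right, norm_smul, mul_pow, Real.norm_eq_abs, sq_abs]
    have : σ ^ 2 * ‖elementary w‖ ^ 2 ≤ σ ^ 2 := by
      have : ‖elementary w‖ ^ 2 ≤ 1 := pow_le_one₀ (norm_nonneg _) hw
      nlinarith [sq_nonneg σ]
    change ‖A‖ ^ 2 - 2 * (σ * σ) + _ ≤ _
    nlinarith
  · rintro r ⟨B, hB, rfl⟩
    obtain ⟨v, rfl⟩ := rankLE_one_iff.1 hB
    exact low v

theorem continuous_elementary :
    Continuous (elementary : (Fin d → EuclideanSpace ℝ (Fin n)) → Tensor d n) := by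
  unfold elementary
  refine (PiLp.continuous_toLp 2 _).comp
    (continuous_pi fun i => continuous_finsetProd _ fun k _ => ?_)
  fun_prop

/-- The maximum of `⟨A, ·⟩` over products of vectors in the unit ball is attained. The absolute
value may be taken because `-elementary v` is elementary for `d > 0`. -/
theorem exists_inner_le (hd : 0 < d) (A : Tensor d n) :
    ∃ w : Fin d → EuclideanSpace ℝ (Fin n), ‖elementary w‖ ≤ 1 ∧
      ∀ v, |inner ℝ A (elementary v)| ≤ inner ℝ A (elementary w) * ‖elementary v‖ := by
  have hc : IsCompact (Set.univ.pi fun _ : Fin d =>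
      Metric.closedBall (0 : EuclideanSpace ℝ (Fin n)) 1) :=
    isCompact_univ_pi fun _ => isCompact_closedBall _ _
  obtain ⟨w, hw, hmax⟩ := hc.exists_isMaxOn ⟨0, fun k _ => by simp⟩
    (f := fun v => inner ℝ A (elementary v))
    (continuous_const.inner continuous_elementary).continuousOn
  have hle : ∀ v, inner ℝ A (elementary v) ≤ inner ℝ A (elementary w) * ‖elementary v‖ := by
    intro v
    have h1 : inner ℝ A (elementary fun k => ‖v k‖⁻¹ • v k) ≤ inner ℝ A (elementary w) := by
      refine hmax fun k _ => ?_
      rw [mem_closedBall_zero_iff, norm_smul, norm_inv, norm_norm]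
      exact inv_mul_le_one
    rw [elementary_smul, inner_smul_right, Finset.prod_inv_distrib, ← norm_elementary] at h1
    rcases (norm_nonneg (elementary v)).eq_or_lt with h0 | h0
    · rw [norm_eq_zero.1 h0.symm]; simp
    · rwa [inv_mul_le_iff₀ h0, mul_comm] at h1
  refine ⟨w, ?_, fun v => abs_le.2 ⟨?_, hle v⟩⟩
  · rw [norm_elementary]
    exact Finset.prod_le_one (fun _ _ => norm_nonneg _) fun k _ => by simpa using hw k trivial
  · obtain ⟨v', hv'⟩ := smul_elementary hd (-1) v
    have := hle v'
    rw [← hv', inner_smul_right, norm_smul] at this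
    simp at this
    linarith

theorem exists_isRelDist_lt (hd : 0 < d) {A : Tensor d n} (hA : A ≠ 0) {K : ℝ}
    (v : Fin d → EuclideanSpace ℝ (Fin n)) (hK1 : K < 1)
    (h : K * ‖A‖ ^ 2 * ‖elementary v‖ ^ 2 < inner ℝ A (elementary v) ^ 2) :
    ∃ m, IsRelDist A m ∧ m < √(1 - K) := by
  obtain ⟨w, hw, hmax⟩ := exists_inner_le hd A
  refine ⟨_, isRelDist_of_forall_inner_le hd hA hw fun v => (le_abs_self _).trans (hmax v), ?_⟩
  have hA' : 0 < ‖A‖ := norm_pos_iff.2 hA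
  apply Real.sqrt_lt_sqrt_iff_of_pos (by linarith) |>.2
  rw [sub_lt_sub_iff_left, lt_div_iff₀ (by positivity)]
  have h1 := pow_le_pow_left₀ (abs_nonneg _) (hmax v) 2
  rw [sq_abs, mul_pow] at h1
  have h2 := h.trans_le h1
  by_contra! hc
  nlinarith [sq_nonneg ‖elementary v‖]

theorem IsSymmetric.inner_elementary_perm {A : Tensor d n} (hA : IsSymmetric A)
    (σ : Equiv.Perm (Fin d)) (z : Fin d → EuclideanSpace ℝ (Fin n)) :
    inner ℝ A (elementary fun k => z (σ k)) = inner ℝ A (elementary z) := by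
  simp only [PiLp.inner_apply, elementary_apply, RCLike.inner_apply, conj_trivial]
  refine Fintype.sum_equiv (Equiv.arrowCongr σ (Equiv.refl _)) _ _ fun i => ?_
  have : (Equiv.arrowCongr σ (Equiv.refl _)) i = fun k => i (σ.symm k) := rfl
  rw [this, hA σ.symm i]
  congr 1
  rw [← Equiv.prod_comp σ fun k => z k (i (σ.symm k))]
  simp


/-! ### Symmetric tensors of rank at most two -/

theorem exists_inner_eq_zero_and_ne_zero {E : Type*} [NormedAddCommGroup E] [InnerProductSpace ℝ E]
    {x y : E} (h : ∀ c : ℝ, x ≠ c • y) : ∃ z : E, inner ℝ y z = 0 ∧ inner ℝ x z ≠ 0 := by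
  by_cases hy : y = 0
  · subst hy
    exact ⟨x, inner_zero_left _, inner_self_ne_zero.2 (by simpa using h 0)⟩
  have hy' : inner ℝ y y ≠ 0 := inner_self_ne_zero.2 hy
  set z := x - (inner ℝ y x / inner ℝ y y : ℝ) • y with hz
  have h1 : inner ℝ y z = 0 := by
    rw [hz, inner_sub_right, inner_smul_right, div_mul_cancel₀ _ hy', sub_self]
  refine ⟨z, h1, fun h2 => ?_⟩
  have : inner ℝ z z = 0 := by
    nth_rewrite 1 [hz]
    rw [inner_sub_left, inner_smul_left, h1, h2]; simp
  exact h _ (sub_eq_zero.1 (inner_self_eq_zero.1 this))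

theorem elementary_eq_zero_of_eq_zero {u : Fin d → EuclideanSpace ℝ (Fin n)} {k : Fin d}
    (h : u k = 0) : elementary u = 0 := by
  rw [← norm_eq_zero, norm_elementary]
  exact Finset.prod_eq_zero (Finset.mem_univ k) (by rw [h, norm_zero])

/-- Contracting the position `l` with a vector orthogonal to `y l` but not to `x l` leaves a
multiple of the product of the remaining `x k`; its invariance under the transposition of `i` and
`j` makes `x i` and `x j` parallel. -/
theorem exists_eq_smul_of_isSymmetric {x y : Fin d → EuclideanSpace ℝ (Fin n)}
    (hA : IsSymmetric (elementary x + elementary y)) (hx : ∀ k, x k ≠ 0) {l : Fin d}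
    (hl : ∀ c : ℝ, x l ≠ c • y l) {i j : Fin d} (hi : i ≠ l) (hj : j ≠ l) :
    ∃ c : ℝ, x j = c • x i := by
  by_cases hij : i = j
  · exact ⟨1, by rw [hij, one_smul]⟩
  obtain ⟨ζ, hζy, hζx⟩ := exists_inner_eq_zero_and_ne_zero hl
  let z : EuclideanSpace ℝ (Fin n) → EuclideanSpace ℝ (Fin n) → Fin d → EuclideanSpace ℝ (Fin n) :=
    fun p q k => if k = l then ζ else if k = i then p else if k = j then q else x k
  have hswap : ∀ p q, (fun k => z p q (Equiv.swap i j k)) = z q p := by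
    intro p q
    funext k
    by_cases h1 : k = l
    · subst h1
      rw [Equiv.swap_apply_of_ne_of_ne hi.symm hj.symm]; simp [z]
    by_cases h2 : k = i
    · subst h2; simp [z, hi, hj, Ne.symm hij]
    by_cases h3 : k = j
    · subst h3; simp [z, hi, hj, h2]
    rw [Equiv.swap_apply_of_ne_of_ne h2 h3]; simp [z, h1, h2, h3]
  set R := ∏ k ∈ ((Finset.univ.erase l).erase i).erase j, inner ℝ (x k) (x k) with hR
  have hR0 : R ≠ 0 := Finset.prod_ne_zero_iff.2 fun k _ => inner_self_ne_zero.2 (hx k)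
  have hval : ∀ p q, inner ℝ (elementary x + elementary y) (elementary (z p q)) =
      inner ℝ (x l) ζ * (inner ℝ (x i) p * (inner ℝ (x j) q * R)) := by
    intro p q
    have h0 : ∏ k, inner ℝ (y k) (z p q k) = 0 :=
      Finset.prod_eq_zero (Finset.mem_univ l) (by simp [z, hζy])
    rw [inner_add_left, inner_elementary, inner_elementary, h0, add_zero,
      ← Finset.mul_prod_erase _ _ (Finset.mem_univ l),
      ← Finset.mul_prod_erase _ _ (Finset.mem_erase.2 ⟨hi, Finset.mem_univ i⟩),
      ← Finset.mul_prod_erase _ _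
        (Finset.mem_erase.2 ⟨Ne.symm hij, Finset.mem_erase.2 ⟨hj, Finset.mem_univ j⟩⟩)]
    congr 1
    · simp [z]
    congr 1
    · simp [z, hi]
    congr 1
    · simp [z, hj, Ne.symm hij]
    refine Finset.prod_congr rfl fun k hk => ?_
    simp only [Finset.mem_erase] at hk
    simp [z, hk.1, hk.2.1, hk.2.2.1]
  have hxi : inner ℝ (x i) (x i) ≠ 0 := inner_self_ne_zero.2 (hx i)
  refine ⟨inner ℝ (x j) (x i) / inner ℝ (x i) (x i), ext_inner_right ℝ fun p => ?_⟩
  have h1 := hA.inner_elementary_perm (Equiv.swap i j) (z p (x i))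
  rw [hswap, hval, hval] at h1
  have h2 : inner ℝ (x l) ζ * R * (inner ℝ (x i) (x i) * inner ℝ (x j) p) =
    inner ℝ (x l) ζ * R * (inner ℝ (x j) (x i) * inner ℝ (x i) p) := by linear_combination h1
  have h3 := mul_left_cancel₀ (mul_ne_zero hζx hR0) h2
  rw [inner_smul_left, conj_trivial]
  field_simp
  linear_combination h3

theorem symPow_smul (c : ℝ) (u : EuclideanSpace ℝ (Fin n)) :
    symPow d (c • u) = c ^ d • symPow d u := by
  have := elementary_smul (fun _ : Fin d => c) (fun _ => u)
  simpa [symPow] using this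

theorem exists_unit_symPow {x : Fin d → EuclideanSpace ℝ (Fin n)} {u : EuclideanSpace ℝ (Fin n)}
    (hu : u ≠ 0) (h : ∀ k, ∃ c : ℝ, x k = c • u) :
    ∃ (α : ℝ) (u' : EuclideanSpace ℝ (Fin n)), ‖u'‖ = 1 ∧ elementary x = α • symPow d u' := by
  choose c hc using h
  refine ⟨(∏ k, c k) * ‖u‖ ^ d, ‖u‖⁻¹ • u, norm_smul_inv_norm hu, ?_⟩
  have : x = fun k => c k • u := funext hc
  have hu' : ‖u‖ ≠ 0 := norm_ne_zero_iff.2 hu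
  rw [this, elementary_smul, symPow_smul, smul_smul, mul_assoc, ← mul_pow, mul_inv_cancel₀ hu',
    one_pow, mul_one, symPow]

/-- A symmetric tensor of rank at most two (with respect to arbitrary elementary tensors) has rank
at most one or is a combination of two symmetric powers. This needs `d ≥ 3`. -/
theorem rankLE_one_or_eq_symPow_add (hd : 3 ≤ d) {A : Tensor d n} (hA : IsSymmetric A)
    (h2 : RankLE 2 A) : RankLE 1 A ∨ ∃ (α β : ℝ) (u v : EuclideanSpace ℝ (Fin n)),
      ‖u‖ = 1 ∧ ‖v‖ = 1 ∧ A = α • symPow d u + β • symPow d v := by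
  obtain ⟨U, hU⟩ := h2
  obtain ⟨x, y, rfl⟩ : ∃ x y, A = elementary x + elementary y :=
    ⟨U 0, U 1, by rw [hU, Fin.sum_univ_two]⟩
  clear hU
  by_cases hx : ∃ k, x k = 0
  · obtain ⟨k, hk⟩ := hx
    exact Or.inl (rankLE_one_iff.2 ⟨y, by rw [elementary_eq_zero_of_eq_zero hk, zero_add]⟩)
  by_cases hy : ∃ k, y k = 0
  · obtain ⟨k, hk⟩ := hy
    exact Or.inl (rankLE_one_iff.2 ⟨x, by rw [elementary_eq_zero_of_eq_zero hk, add_zero]⟩)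
  push Not at hx hy
  have hsymm : ∀ k, (∀ c : ℝ, x k ≠ c • y k) → ∀ c : ℝ, y k ≠ c • x k := by
    intro k h c hc
    have hc0 : c ≠ 0 := by rintro rfl; exact hy k (by simpa using hc)
    exact h c⁻¹ (by rw [hc, smul_smul, inv_mul_cancel₀ hc0, one_smul])
  by_cases hgood : ∃ k₁ k₂, k₁ ≠ k₂ ∧ (∀ c : ℝ, x k₁ ≠ c • y k₁) ∧ (∀ c : ℝ, x k₂ ≠ c • y k₂)
  · obtain ⟨k₁, k₂, hne, h1, h2⟩ := hgood
    right
    obtain ⟨k₃, hk₃⟩ : ∃ k₃, k₃ ∉ ({k₁, k₂} : Finset (Fin d)) := by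
      by_contra! h
      have h3 := Finset.card_le_card (fun k _ => h k : (Finset.univ : Finset (Fin d)) ⊆ {k₁, k₂})
      have h4 := Finset.card_le_two (a := k₁) (b := k₂)
      simp only [Finset.card_univ, Fintype.card_fin] at h3
      omega
    simp only [Finset.mem_insert, Finset.mem_singleton, not_or] at hk₃
    have hA' : IsSymmetric (elementary y + elementary x) := by rwa [add_comm]
    have hxp : ∀ k, ∃ c : ℝ, x k = c • x k₃ := fun k => by
      by_cases hk : k = k₁
      · exact exists_eq_smul_of_isSymmetric hA hx h2 hk₃.2 (hk ▸ hne)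
      · exact exists_eq_smul_of_isSymmetric hA hx h1 hk₃.1 hk
    have hyp : ∀ k, ∃ c : ℝ, y k = c • y k₃ := fun k => by
      by_cases hk : k = k₁
      · exact exists_eq_smul_of_isSymmetric hA' hy (hsymm _ h2) hk₃.2 (hk ▸ hne)
      · exact exists_eq_smul_of_isSymmetric hA' hy (hsymm _ h1) hk₃.1 hk
    obtain ⟨α, u, hu, hα⟩ := exists_unit_symPow (hx k₃) hxp
    obtain ⟨β, v, hv, hβ⟩ := exists_unit_symPow (hy k₃) hyp
    exact ⟨α, β, u, v, hu, hv, by rw [hα, hβ]⟩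
  · left
    push Not at hgood
    obtain ⟨l, hl⟩ : ∃ l, ∀ k, k ≠ l → ∃ c : ℝ, x k = c • y k := by
      by_cases h : ∃ l, ∀ c : ℝ, x l ≠ c • y l
      · obtain ⟨l, hl⟩ := h
        exact ⟨l, fun k hk => hgood l k hk.symm hl⟩
      · push Not at h
        exact ⟨⟨0, by omega⟩, fun k _ => h k⟩
    have : ∀ k, ∃ c : ℝ, x k = c • Function.update y l (x l) k := fun k => by
      by_cases hk : k = l
      · subst hk; exact ⟨1, by simp⟩
      · obtain ⟨c, hc⟩ := hl k hk
        exact ⟨c, by rw [Function.update_of_ne hk, hc]⟩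
    choose c hc using this
    refine rankLE_one_iff.2 ⟨Function.update y l ((∏ k, c k) • x l + y l), ?_⟩
    rw [elementary_update_add, elementary_update_smul, Function.update_eq_self, ← elementary_smul,
      ← funext hc]

theorem inner_symPow (u v : EuclideanSpace ℝ (Fin n)) :
    inner ℝ (symPow d u) (symPow d v) = inner ℝ u v ^ d := by
  simp [symPow, inner_elementary]

theorem norm_symPow (u : EuclideanSpace ℝ (Fin n)) : ‖symPow d u‖ = ‖u‖ ^ d := by
  simp [symPow, norm_elementary]

/-! ### Lower bound for the spectral norm -/

/-- Some elementary tensor certifies that the spectral norm of `A`, squared, exceeds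
`(1 - 1/d)^(d-1) * ‖A‖ ^ 2`. -/
def HasLargeInner (A : Tensor d n) : Prop :=
  ∃ v, (1 - 1 / (d : ℝ)) ^ (d - 1) * ‖A‖ ^ 2 * ‖elementary v‖ ^ 2 < inner ℝ A (elementary v) ^ 2

theorem hasLargeInner_of_rankLE_one (hd : 3 ≤ d) {A : Tensor d n} (hA : A ≠ 0) (h : RankLE 1 A) :
    HasLargeInner A := by
  obtain ⟨v, rfl⟩ := rankLE_one_iff.1 h
  refine ⟨v, ?_⟩
  have := norm_pos_iff.2 hA
  rw [real_inner_self_eq_norm_sq, mul_assoc, ← sq]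
  have h1 := two_mul_one_sub_pow_lt hd
  have h2 : 0 < (‖elementary v‖ ^ 2) ^ 2 := by positivity
  nlinarith

/-- The test vector is `u` unless `β < 0` and `0 < ⟨u, v⟩ < 1`, when it lies in the plane of `u` and
`v` at the angle from `exists_angle_lt`. -/
theorem hasLargeInner_symPow_add_of_abs_le (hd : 3 ≤ d) {α β : ℝ} {u v : EuclideanSpace ℝ (Fin n)}
    (hu : ‖u‖ = 1) (hv : ‖v‖ = 1) (hα : 0 < α) (hβ : |β| ≤ α) (huv : 0 ≤ inner ℝ u v)
    (hA : α • symPow d u + β • symPow d v ≠ 0) :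
    HasLargeInner (α • symPow d u + β • symPow d v) := by
  set A := α • symPow d u + β • symPow d v with hAdef
  set c := inner ℝ u v with hc
  have hc1 : c ≤ 1 := by simpa [hu, hv] using real_inner_le_norm u v
  have hcd0 : 0 ≤ c ^ d := pow_nonneg huv d
  have hcd1 : c ^ d ≤ 1 := pow_le_one₀ huv hc1
  have hin : ∀ w, inner ℝ A (symPow d w) = α * inner ℝ u w ^ d + β * inner ℝ v w ^ d := fun w => by
    rw [hAdef, inner_add_left, inner_smul_left, inner_smul_left, inner_symPow, inner_symPow]; simp
  have huu : inner ℝ u u = 1 := by rw [real_inner_self_eq_norm_sq, hu, one_pow]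
  have hvv : inner ℝ v v = 1 := by rw [real_inner_self_eq_norm_sq, hv, one_pow]
  have hvu : inner ℝ v u = c := real_inner_comm _ _
  have hnorm : ‖A‖ ^ 2 = α ^ 2 + β ^ 2 + 2 * (α * β * c ^ d) := by
    rw [← real_inner_self_eq_norm_sq]
    nth_rewrite 2 [hAdef]
    rw [inner_add_right, inner_smul_right, inner_smul_right, hin, hin, huu, hvv, hvu, ← hc]
    ring
  have hK := two_mul_one_sub_pow_lt hd
  have hK0 := one_sub_pow_pos hd
  have of_unit : ∀ w : EuclideanSpace ℝ (Fin n), ‖w‖ = 1 →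
      (1 - 1 / (d : ℝ)) ^ (d - 1) * (α ^ 2 + β ^ 2 + 2 * (α * β * c ^ d)) <
        (α * inner ℝ u w ^ d + β * inner ℝ v w ^ d) ^ 2 → HasLargeInner A := by
    intro w hw h
    refine ⟨fun _ => w, ?_⟩
    change _ * ‖symPow d w‖ ^ 2 < inner ℝ A (symPow d w) ^ 2
    rw [norm_symPow, hw, one_pow, one_pow, mul_one, hin, hnorm]
    exact h
  have hβ2 : β ^ 2 ≤ α ^ 2 := sq_le_sq' (by linarith [neg_abs_le β]) (by linarith [le_abs_self β])
  have hpos : 0 < ‖A‖ ^ 2 := by have := norm_pos_iff.2 hA; positivity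
  rw [hnorm] at hpos
  rcases le_or_gt 0 β with h0 | h0
  · refine of_unit u hu ?_
    rw [huu, hvu, one_pow, mul_one]
    have h1 : 0 ≤ α * β * c ^ d := by positivity
    nlinarith [sq_nonneg (β * c ^ d)]
  rcases huv.eq_or_lt with hc0 | hc0
  · refine of_unit u hu ?_
    rw [huu, hvu, ← hc0, zero_pow (by omega)]
    rw [← hc0, zero_pow (by omega)] at hpos
    simp only [one_pow, mul_one, mul_zero, add_zero] at hpos ⊢
    nlinarith [mul_lt_mul_of_pos_right hK hpos]
  rcases hc1.eq_or_lt with hc1' | hc1'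
  · have : u = v := (inner_eq_one_iff_of_norm_eq_one hu hv).1 hc1'
    refine hasLargeInner_of_rankLE_one hd hA (rankLE_one_iff.2 ?_)
    obtain ⟨z, hz⟩ := smul_elementary (by omega : 0 < d) (α + β) fun _ => v
    exact ⟨z, by rw [hAdef, this, ← add_smul, ← hz]; rfl⟩
  have hcos : Real.cos (Real.arccos c) = c := Real.cos_arccos (by linarith) hc1
  have hsin : Real.sin (Real.arccos c) ^ 2 = 1 - c ^ 2 := by
    rw [Real.sin_sq, hcos]
  have hsin0 : 0 < Real.sin (Real.arccos c) :=
    Real.sin_pos_of_pos_of_lt_pi (Real.arccos_pos.2 hc1')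
      ((Real.arccos_lt_pi_div_two.2 hc0).trans (by linarith [Real.pi_pos]))
  obtain ⟨η, hη⟩ := exists_angle_lt hd (δ := Real.arccos c) (t := -β / α) (Real.arccos_pos.2 hc1')
    (Real.arccos_lt_pi_div_two.2 hc0) (div_pos (by linarith) hα)
    (by rw [div_le_one hα]; linarith [neg_abs_le β])
  rw [Real.cos_add, hcos] at hη
  set S := Real.sin (Real.arccos c) with hS
  set w := Real.cos η • u - (Real.sin η / S) • (v - c • u) with hw
  have huw : inner ℝ u w = Real.cos η := by
    rw [hw, inner_sub_right, inner_smul_right, inner_smul_right, inner_sub_right, inner_smul_right,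
      huu, ← hc]; ring
  have hvw : inner ℝ v w = Real.cos η * c - Real.sin η * S := by
    rw [hw, inner_sub_right, inner_smul_right, inner_smul_right, inner_sub_right, inner_smul_right,
      hvv, hvu, show 1 - c * c = S ^ 2 by rw [hsin]; ring]
    field_simp
  refine of_unit w ?_ ?_
  · have : ‖w‖ ^ 2 = 1 := by
      rw [← real_inner_self_eq_norm_sq]
      nth_rewrite 1 [hw]
      rw [inner_sub_left, inner_smul_left, inner_smul_left, inner_sub_left, inner_smul_left, huw,
        hvw]
      simp only [conj_trivial]
      have := Real.sin_sq_add_cos_sq η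
      field_simp
      linear_combination S * this
    exact (pow_eq_one_iff_of_nonneg (norm_nonneg w) two_ne_zero).1 this
  · rw [huw, hvw]
    have := mul_lt_mul_of_pos_right hη (pow_pos hα 2)
    refine lt_of_eq_of_lt ?_ (this.trans_eq ?_) <;> field_simp <;> ring

theorem HasLargeInner.neg {A : Tensor d n} (h : HasLargeInner A) : HasLargeInner (-A) := by
  obtain ⟨v, hv⟩ := h
  exact ⟨v, by rwa [norm_neg, inner_neg_left, neg_sq]⟩

/-- Exchanging the two powers, replacing `v` by `-v` and negating the tensor reduce the claim to
`hasLargeInner_symPow_add_of_abs_le`. -/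
theorem hasLargeInner_symPow_add (hd : 3 ≤ d) {α β : ℝ} {u v : EuclideanSpace ℝ (Fin n)}
    (hu : ‖u‖ = 1) (hv : ‖v‖ = 1) (hA : α • symPow d u + β • symPow d v ≠ 0) :
    HasLargeInner (α • symPow d u + β • symPow d v) := by
  wlog hαβ : |β| ≤ |α| generalizing α β u v
  · rw [add_comm] at hA ⊢
    exact this hv hu hA (not_le.1 hαβ).le
  wlog huv : 0 ≤ inner ℝ u v generalizing β v
  · have e : β • symPow d v = (β * (-1) ^ d) • symPow d (-v) := by
      rw [← neg_one_smul ℝ v, symPow_smul, smul_smul, mul_assoc, ← mul_pow]; simp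
    rw [e] at hA ⊢
    refine this (by rwa [norm_neg]) hA (by simpa [abs_mul] using hαβ) ?_
    rw [inner_neg_right]
    linarith
  wlog hα : 0 ≤ α generalizing α β
  · have e : α • symPow d u + β • symPow d v = -((-α) • symPow d u + (-β) • symPow d v) := by
      rw [neg_smul, neg_smul]; abel
    rw [e] at hA ⊢
    exact (this (neg_ne_zero.1 hA) (by simpa using hαβ) (by linarith)).neg
  rw [abs_of_nonneg hα] at hαβ
  rcases hα.eq_or_lt with h0 | h0
  · subst h0
    have : β = 0 := abs_nonpos_iff.1 hαβ
    simp [this] at hA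
  exact hasLargeInner_symPow_add_of_abs_le hd hu hv h0 hαβ huv hA

theorem exists_isRelDist_lt_of_rankLE_two (hd : 3 ≤ d) {A : Tensor d n} (hA : A ≠ 0)
    (hs : IsSymmetric A) (h2 : RankLE 2 A) :
    ∃ m, IsRelDist A m ∧ m < √(1 - (1 - 1 / (d : ℝ)) ^ (d - 1)) := by
  have : HasLargeInner A := by
    rcases rankLE_one_or_eq_symPow_add hd hs h2 with h | ⟨α, β, u, v, hu, hv, rfl⟩
    · exact hasLargeInner_of_rankLE_one hd hA h
    · exact hasLargeInner_symPow_add hd hu hv hA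
  obtain ⟨v, hv⟩ := this
  have hK := two_mul_one_sub_pow_lt hd
  have hK0 := one_sub_pow_pos hd
  exact exists_isRelDist_lt (by omega) hA v (by linarith) hv

/-! ### A product inequality -/

theorem one_add_sum_le_prod_one_add_of_nonneg {ι : Type*} (s : Finset ι) {f : ι → ℝ}
    (hf : ∀ i ∈ s, 0 ≤ f i) : 1 + ∑ i ∈ s, f i ≤ ∏ i ∈ s, (1 + f i) := by
  classical
  induction s using Finset.induction_on with
  | empty => simp
  | insert a s ha ih =>
    rw [Finset.sum_insert ha, Finset.prod_insert ha]
    have h1 := hf a (Finset.mem_insert_self a s)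
    have h2 : ∀ i ∈ s, 0 ≤ f i := fun i hi => hf i (Finset.mem_insert_of_mem hi)
    have h3 := ih h2
    have h4 := Finset.sum_nonneg h2
    nlinarith

theorem one_add_sum_le_prod_one_add_of_nonpos {ι : Type*} (s : Finset ι) {f : ι → ℝ}
    (hf : ∀ i ∈ s, -1 ≤ f i ∧ f i ≤ 0) : 1 + ∑ i ∈ s, f i ≤ ∏ i ∈ s, (1 + f i) := by
  classical
  induction s using Finset.induction_on with
  | empty => simp
  | insert a s ha ih =>
    rw [Finset.sum_insert ha, Finset.prod_insert ha]
    have h1 := hf a (Finset.mem_insert_self a s)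
    have h2 : ∀ i ∈ s, -1 ≤ f i ∧ f i ≤ 0 := fun i hi => hf i (Finset.mem_insert_of_mem hi)
    have h3 := ih h2
    have h4 := Finset.sum_nonpos fun i hi => (h2 i hi).2
    nlinarith

/-- The inequality `d^(d-2) (∑ a_k)² ≤ ∏ (a_k² + d - 1)`. Bernoulli's inequality applies to the
factors with `a_k² ≥ 1` and to those with `a_k² < 1` separately, and Cauchy–Schwarz to the product
of the two resulting sums. -/
theorem sum_sq_le_prod {d : ℕ} (hd : 0 < d) (a : Fin d → ℝ) :
    (∑ k, a k) ^ 2 ≤ d ^ 2 * ∏ k, (1 + (a k ^ 2 - 1) / d) := by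
  have hd' : (0 : ℝ) < d := by exact_mod_cast hd
  have hd1 : (1 : ℝ) ≤ d := by exact_mod_cast hd
  have hI := one_add_sum_le_prod_one_add_of_nonneg (Finset.univ.filter fun k => 1 ≤ a k ^ 2)
    (f := fun k => (a k ^ 2 - 1) / d) (fun k hk => by
      have := (Finset.mem_filter.1 hk).2
      exact div_nonneg (by linarith) hd'.le)
  have hJ := one_add_sum_le_prod_one_add_of_nonpos (Finset.univ.filter fun k => ¬ 1 ≤ a k ^ 2)
    (f := fun k => (a k ^ 2 - 1) / d) (fun k hk => by
      have := (Finset.mem_filter.1 hk).2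
      constructor
      · rw [le_div_iff₀ hd']; nlinarith [sq_nonneg (a k)]
      · exact div_nonpos_of_nonpos_of_nonneg (by linarith) hd'.le)
  have hCS := Finset.sum_mul_sq_le_sq_mul_sq Finset.univ
    (fun k => if 1 ≤ a k ^ 2 then a k else 1) (fun k => if 1 ≤ a k ^ 2 then 1 else a k)
  have e : ∀ k, (if 1 ≤ a k ^ 2 then a k else 1) * (if 1 ≤ a k ^ 2 then 1 else a k) = a k := by
    intro k; split_ifs <;> simp
  simp only [e] at hCS
  have e1 : 1 + ∑ k ∈ Finset.univ.filter (fun k => 1 ≤ a k ^ 2), (a k ^ 2 - 1) / d =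
      (∑ k, (if 1 ≤ a k ^ 2 then a k else 1) ^ 2) / d := by
    rw [Finset.sum_filter, eq_div_iff hd'.ne', add_mul, Finset.sum_mul, one_mul]
    have : (d : ℝ) = ∑ _k : Fin d, (1 : ℝ) := by simp
    nth_rewrite 1 [this]
    rw [← Finset.sum_add_distrib]
    refine Finset.sum_congr rfl fun k _ => ?_
    split_ifs <;> field_simp <;> ring
  have e2 : 1 + ∑ k ∈ Finset.univ.filter (fun k => ¬ 1 ≤ a k ^ 2), (a k ^ 2 - 1) / d =
      (∑ k, (if 1 ≤ a k ^ 2 then 1 else a k) ^ 2) / d := by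
    rw [Finset.sum_filter, eq_div_iff hd'.ne', add_mul, Finset.sum_mul, one_mul]
    have : (d : ℝ) = ∑ _k : Fin d, (1 : ℝ) := by simp
    nth_rewrite 1 [this]
    rw [← Finset.sum_add_distrib]
    refine Finset.sum_congr rfl fun k _ => ?_
    split_ifs <;> field_simp <;> ring
  rw [e1] at hI
  rw [e2] at hJ
  have h := mul_le_mul hI hJ (by positivity) (le_trans (by positivity) hI)
  rw [Finset.prod_filter_mul_prod_filter_not] at h
  calc _ ≤ _ := hCS
    _ = d ^ 2 * (((∑ k, (if 1 ≤ a k ^ 2 then a k else 1) ^ 2) / d) *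
      ((∑ k, (if 1 ≤ a k ^ 2 then 1 else a k) ^ 2) / d)) := by field_simp
    _ ≤ _ := by gcongr

/-- For nonzero `x k` this is `sum_sq_le_prod` with `a k = √(d - 1) * (y k / x k)`. If some `x l`
vanishes, only one summand survives and `d * (1 - 1/d)^(d-1) ≥ 1` suffices. -/
theorem sum_mul_prod_erase_sq_le (hd : 3 ≤ d) (x y : Fin d → ℝ) :
    (∑ k, y k * ∏ j ∈ Finset.univ.erase k, x j) ^ 2 ≤
      d * (1 - 1 / (d : ℝ)) ^ (d - 1) * ∏ k, (x k ^ 2 + y k ^ 2) := by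
  have hd' : (3 : ℝ) ≤ d := by exact_mod_cast hd
  by_cases hx : ∃ l, x l = 0
  · obtain ⟨l, hl⟩ := hx
    rw [Finset.sum_eq_single l (fun k _ hk => by
      rw [Finset.prod_eq_zero (Finset.mem_erase.2 ⟨hk.symm, Finset.mem_univ l⟩) hl, mul_zero])
      (by simp), mul_pow, ← Finset.prod_pow]
    have h1 : y l ^ 2 * ∏ k ∈ Finset.univ.erase l, x k ^ 2 ≤ ∏ k, (x k ^ 2 + y k ^ 2) := by
      rw [← Finset.mul_prod_erase _ _ (Finset.mem_univ l)]
      refine mul_le_mul (by nlinarith [sq_nonneg (x l)]) (Finset.prod_le_prod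
        (fun _ _ => sq_nonneg _) fun k _ => by nlinarith [sq_nonneg (y k)])
        (Finset.prod_nonneg fun _ _ => sq_nonneg _) (by positivity)
    have h2 : 0 ≤ ∏ k, (x k ^ 2 + y k ^ 2) := Finset.prod_nonneg fun _ _ => by positivity
    nlinarith [one_le_mul_one_sub_pow hd]
  push Not at hx
  have h := sum_sq_le_prod (by omega : 0 < d) fun k => √(d - 1) * (y k / x k)
  have hs : √((d : ℝ) - 1) ^ 2 = d - 1 := Real.sq_sqrt (by linarith)
  have e1 : ∀ k, 1 + ((√((d : ℝ) - 1) * (y k / x k)) ^ 2 - 1) / d =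
      (1 - 1 / (d : ℝ)) * ((x k ^ 2 + y k ^ 2) / x k ^ 2) := by
    intro k
    have := hx k
    rw [mul_pow, hs]
    field_simp
    ring
  simp only [e1] at h
  rw [← Finset.mul_sum, mul_pow, hs, Finset.prod_mul_distrib, Finset.prod_const, Finset.card_univ,
    Fintype.card_fin, Finset.prod_div_distrib, Finset.prod_pow] at h
  have hX : ∏ k, x k ≠ 0 := Finset.prod_ne_zero_iff.2 fun k _ => hx k
  have e2 : ∑ k, y k * ∏ j ∈ Finset.univ.erase k, x j = (∑ k, y k / x k) * ∏ k, x k := by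
    rw [Finset.sum_mul]
    refine Finset.sum_congr rfl fun k _ => ?_
    have := hx k
    rw [← Finset.mul_prod_erase _ x (Finset.mem_univ k)]
    field_simp
  have e3 : (1 - 1 / (d : ℝ)) ^ d = (1 - 1 / (d : ℝ)) ^ (d - 1) * ((d - 1) / d) := by
    rw [← one_sub_div (by positivity), ← pow_succ]
    congr 1; omega
  rw [e2, mul_pow]
  have hX2 : 0 < (∏ k, x k) ^ 2 := by positivity
  have hd1 : (0 : ℝ) < d - 1 := by linarith
  rw [e3] at h
  have h4 := mul_le_mul_of_nonneg_right h (div_nonneg hX2.le hd1.le)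
  refine (le_of_eq ?_).trans (h4.trans_eq ?_) <;> field_simp

/-! ### Tangents to the curve of symmetric powers -/

/-- The derivative at `t = 0` of `(x + t y)^d`, that is, the sum over the `d` positions of the
elementary tensor with `y` in that position and `x` elsewhere. -/
noncomputable def tangent (d : ℕ) (x y : EuclideanSpace ℝ (Fin n)) : Tensor d n :=
  ∑ k : Fin d, elementary (Function.update (fun _ => x) k y)

theorem inner_tangent (x y : EuclideanSpace ℝ (Fin n)) (u : Fin d → EuclideanSpace ℝ (Fin n)) :
    inner ℝ (tangent d x y) (elementary u) =
      ∑ k, inner ℝ y (u k) * ∏ j ∈ Finset.univ.erase k, inner ℝ x (u j) := by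
  rw [tangent, sum_inner]
  refine Finset.sum_congr rfl fun k _ => ?_
  rw [inner_elementary, ← Finset.mul_prod_erase _ _ (Finset.mem_univ k), Function.update_self]
  congr 1
  exact Finset.prod_congr rfl fun j hj => by rw [Function.update_of_ne (Finset.ne_of_mem_erase hj)]

theorem tendsto_symPow_slope (x y : EuclideanSpace ℝ (Fin n)) :
    Tendsto (fun t : ℝ => (1 / t) • (symPow d (x + t • y) - symPow d x)) (𝓝[≠] 0)
      (𝓝 (tangent d x y)) := by
  have h : Tendsto (fun t : ℝ => fun i : Fin d → Fin n =>
      ((1 / t) • (symPow d (x + t • y) - symPow d x)) i) (𝓝[≠] 0)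
      (𝓝 fun i => tangent d x y i) := by
    refine tendsto_pi_nhds.2 fun i => ?_
    have h1 : HasDerivAt (fun t : ℝ => ∏ k, (x (i k) + t * y (i k)))
        (∑ k, (∏ j ∈ Finset.univ.erase k, (x (i j) + 0 * y (i j))) • y (i k)) 0 :=
      HasDerivAt.fun_finsetProd fun k _ =>
        (((hasDerivAt_id (0 : ℝ)).mul_const (y (i k))).const_add _).congr_deriv (one_mul _)
    have h2 := hasDerivAt_iff_tendsto_slope_zero.1 h1
    have e : ∑ k, (∏ j ∈ Finset.univ.erase k, (x (i j) + 0 * y (i j))) • y (i k) =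
        tangent d x y i := by
      rw [tangent, WithLp.ofLp_sum, Finset.sum_apply]
      refine Finset.sum_congr rfl fun k _ => ?_
      rw [elementary_apply, ← Finset.mul_prod_erase _ _ (Finset.mem_univ k), Function.update_self,
        smul_eq_mul, mul_comm]
      congr 1
      exact Finset.prod_congr rfl fun j hj => by
        rw [Function.update_of_ne (Finset.ne_of_mem_erase hj), zero_mul, add_zero]
    rw [e] at h2
    refine h2.congr fun t => ?_
    simp [symPow, elementary_apply]
  exact ((PiLp.continuous_toLp 2 _).tendsto _).comp h

variable {x y : EuclideanSpace ℝ (Fin n)}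

theorem inner_sq_add_inner_sq_le (hx : ‖x‖ = 1) (hy : ‖y‖ = 1) (hxy : inner ℝ x y = 0)
    (u : EuclideanSpace ℝ (Fin n)) : inner ℝ x u ^ 2 + inner ℝ y u ^ 2 ≤ ‖u‖ ^ 2 := by
  have hxx : inner ℝ x x = 1 := by rw [real_inner_self_eq_norm_sq, hx, one_pow]
  have hyy : inner ℝ y y = 1 := by rw [real_inner_self_eq_norm_sq, hy, one_pow]
  have hyx : inner ℝ y x = 0 := by rw [real_inner_comm, hxy]
  have h := real_inner_self_nonneg (x := u - inner ℝ x u • x - inner ℝ y u • y)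
  simp only [inner_sub_left, inner_sub_right, inner_smul_left, inner_smul_right, conj_trivial,
    hxx, hyy, hxy, hyx, real_inner_comm x u, real_inner_comm y u] at h
  rw [real_inner_self_eq_norm_sq] at h
  nlinarith

theorem inner_tangent_sq_le (hd : 3 ≤ d) (hx : ‖x‖ = 1) (hy : ‖y‖ = 1) (hxy : inner ℝ x y = 0)
    (u : Fin d → EuclideanSpace ℝ (Fin n)) : inner ℝ (tangent d x y) (elementary u) ^ 2 ≤
      d * (1 - 1 / (d : ℝ)) ^ (d - 1) * ‖elementary u‖ ^ 2 := by
  rw [inner_tangent]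
  refine (sum_mul_prod_erase_sq_le hd _ _).trans ?_
  rw [norm_elementary, ← Finset.prod_pow]
  have := one_sub_pow_pos hd
  refine mul_le_mul_of_nonneg_left (Finset.prod_le_prod (fun _ _ => by positivity) fun k _ => ?_)
    (by positivity)
  exact inner_sq_add_inner_sq_le hx hy hxy (u k)

theorem norm_tangent_sq (hx : ‖x‖ = 1) (hy : ‖y‖ = 1) (hxy : inner ℝ x y = 0) :
    ‖tangent d x y‖ ^ 2 = d := by
  have hxx : inner ℝ x x = 1 := by rw [real_inner_self_eq_norm_sq, hx, one_pow]
  have hyy : inner ℝ y y = 1 := by rw [real_inner_self_eq_norm_sq, hy, one_pow]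
  have hyx : inner ℝ y x = 0 := by rw [real_inner_comm, hxy]
  rw [← real_inner_self_eq_norm_sq]
  nth_rewrite 2 [tangent]
  rw [inner_sum, Finset.sum_congr rfl (g := fun _ => (1 : ℝ))]
  · simp
  intro l _
  rw [inner_tangent, Finset.sum_eq_single l]
  · rw [Function.update_self, hyy, one_mul]
    refine Finset.prod_eq_one fun j hj => ?_
    rw [Function.update_of_ne (Finset.ne_of_mem_erase hj), hxx]
  · intro k _ hk
    rw [Function.update_of_ne hk, hyx, zero_mul]
  · simp

theorem isRelDist_tangent (hd : 3 ≤ d) (hx : ‖x‖ = 1) (hy : ‖y‖ = 1) (hxy : inner ℝ x y = 0) :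
    IsRelDist (tangent d x y) (√(1 - (1 - 1 / (d : ℝ)) ^ (d - 1))) := by
  have hd' : (3 : ℝ) ≤ d := by exact_mod_cast hd
  have hxx : inner ℝ x x = 1 := by rw [real_inner_self_eq_norm_sq, hx, one_pow]
  have hyy : inner ℝ y y = 1 := by rw [real_inner_self_eq_norm_sq, hy, one_pow]
  have hyx : inner ℝ y x = 0 := by rw [real_inner_comm, hxy]
  have hn := norm_tangent_sq (d := d) hx hy hxy
  have h0 : tangent d x y ≠ 0 := by
    intro h
    rw [h, norm_zero] at hn
    linarith
  have hκ : 0 ≤ 1 - 1 / (d : ℝ) := by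
    rw [sub_nonneg, div_le_one (by positivity)]; linarith
  -- The maximiser of `d * ⟨x, w⟩ ^ (d - 1) * ⟨y, w⟩` on the unit circle.
  set w := √(1 - 1 / (d : ℝ)) • x + √(1 / (d : ℝ)) • y with hw
  have hxw : inner ℝ x w = √(1 - 1 / (d : ℝ)) := by
    rw [hw, inner_add_right, inner_smul_right, inner_smul_right, hxx, hxy]; simp
  have hyw : inner ℝ y w = √(1 / (d : ℝ)) := by
    rw [hw, inner_add_right, inner_smul_right, inner_smul_right, hyx, hyy]; simp
  have hw1 : ‖w‖ ^ 2 = 1 := by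
    rw [← real_inner_self_eq_norm_sq]
    nth_rewrite 1 [hw]
    rw [inner_add_left, inner_smul_left, inner_smul_left, hxw, hyw, conj_trivial, conj_trivial,
      Real.mul_self_sqrt hκ, Real.mul_self_sqrt (by positivity)]
    ring
  have hw1' : ‖w‖ = 1 := (pow_eq_one_iff_of_nonneg (norm_nonneg w) two_ne_zero).1 hw1
  have hval : inner ℝ (tangent d x y) (elementary fun _ => w) =
      d * (√(1 / (d : ℝ)) * √(1 - 1 / (d : ℝ)) ^ (d - 1)) := by
    rw [inner_tangent]
    simp [hxw, hyw, Finset.card_erase_of_mem]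
  have hval2 : inner ℝ (tangent d x y) (elementary fun _ => w) ^ 2 =
      d * (1 - 1 / (d : ℝ)) ^ (d - 1) := by
    rw [hval, mul_pow, mul_pow, Real.sq_sqrt (by positivity), ← pow_mul, mul_comm (d - 1), pow_mul,
      Real.sq_sqrt hκ]
    field_simp
  have key := isRelDist_of_forall_inner_le (by omega) h0 (w := fun _ => w)
    (by rw [norm_elementary]; simp [hw1']) (fun v => by
      have h1 := inner_tangent_sq_le hd hx hy hxy v
      rw [← hval2, ← mul_pow] at h1
      have h2 : 0 ≤ inner ℝ (tangent d x y) (elementary fun _ => w) := by rw [hval]; positivity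
      exact (le_abs_self _).trans (abs_le_of_sq_le_sq h1 (by positivity)))
  rwa [hval2, hn, mul_div_cancel_left₀ _ (by positivity)] at key

/-! ### The tensor `W d` -/

/-- Averaging over all permutations `σ` makes `σ l` uniformly distributed. -/
theorem sum_perm_apply {ι M : Type*} [Fintype ι] [DecidableEq ι] [AddCommGroup M] [Module ℝ M]
    (g : ι → M) (l : ι) : (Fintype.card ι : ℝ) • ∑ σ : Equiv.Perm ι, g (σ l) =
      ((Fintype.card ι).factorial : ℝ) • ∑ k, g k := by
  have h : ∀ l', ∑ σ : Equiv.Perm ι, g (σ l') = ∑ σ : Equiv.Perm ι, g (σ l) := fun l' =>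
    Fintype.sum_equiv (Equiv.mulRight (Equiv.swap l l')) _ _ fun σ => by simp
  calc _ = ∑ l', ∑ σ : Equiv.Perm ι, g (σ l') := by
        simp only [h, Finset.sum_const, Finset.card_univ, Nat.cast_smul_eq_nsmul]
    _ = ∑ σ : Equiv.Perm ι, ∑ l', g (σ l') := Finset.sum_comm
    _ = ∑ σ : Equiv.Perm ι, ∑ k, g k := Finset.sum_congr rfl fun σ _ => Equiv.sum_comp σ g
    _ = _ := by
        rw [Finset.sum_const, Finset.card_univ, Fintype.card_perm, Nat.cast_smul_eq_nsmul]

theorem W_eq_tangent (hd : 0 < d) (hn : 2 ≤ n) : W d hn = tangent d (e₁ hn) (e₂ hn) := by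
  let l : Fin d := ⟨d - 1, by omega⟩
  let g : Fin d → Tensor d n := fun k => elementary (Function.update (fun _ => e₁ hn) k (e₂ hn))
  have h1 : ∀ σ : Equiv.Perm (Fin d),
      elementary (fun k => (fun k : Fin d => if (k : ℕ) + 1 = d then e₂ hn else e₁ hn) (σ k)) =
        g (σ⁻¹ l) := by
    intro σ
    refine congrArg elementary (funext fun k => ?_)
    have : ((σ k : ℕ) + 1 = d) ↔ k = σ⁻¹ l := by
      rw [Equiv.Perm.eq_inv_iff_eq, Fin.ext_iff]
      change _ ↔ (σ k : ℕ) = d - 1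
      omega
    simp only [this, Function.update_apply]
  rw [W, symProd, Finset.sum_congr rfl fun σ _ => h1 σ,
    Fintype.sum_equiv (Equiv.inv (Equiv.Perm (Fin d))) (fun σ => g (σ⁻¹ l)) (fun σ => g (σ l))
      (fun σ => rfl), smul_comm]
  have := sum_perm_apply g l
  rw [Fintype.card_fin] at this
  rw [this, smul_smul, one_div_mul_cancel (by positivity), one_smul, tangent]

/-! ### Sharpness -/

theorem isSymmetric_symProd (u : Fin d → EuclideanSpace ℝ (Fin n)) : IsSymmetric (symProd u) := by
  intro τ i
  simp only [symProd, PiLp.smul_apply, WithLp.ofLp_sum, Finset.sum_apply, elementary_apply]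
  congr 1
  refine Fintype.sum_equiv (Equiv.mulRight τ⁻¹) _ _ fun σ => ?_
  rw [← Equiv.prod_comp τ fun k => u ((Equiv.mulRight τ⁻¹) σ k) (i k)]
  simp

theorem IsSymmetric.smul {A : Tensor d n} (hA : IsSymmetric A) (c : ℝ) : IsSymmetric (c • A) :=
  fun σ i => by simp only [PiLp.smul_apply, hA σ i]

theorem IsSymmetric.sub {A B : Tensor d n} (hA : IsSymmetric A) (hB : IsSymmetric B) :
    IsSymmetric (A - B) :=
  fun σ i => by simp only [PiLp.sub_apply, hA σ i, hB σ i]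

theorem isSymmetric_symPow (u : EuclideanSpace ℝ (Fin n)) : IsSymmetric (symPow d u) :=
  fun σ i => Equiv.prod_comp σ fun k => u (i k)

theorem rankLE_two_smul_sub (hd : 0 < d) (c : ℝ) (u v : Fin d → EuclideanSpace ℝ (Fin n)) :
    RankLE 2 (c • (elementary u - elementary v)) := by
  obtain ⟨u', hu'⟩ := smul_elementary hd c u
  obtain ⟨v', hv'⟩ := smul_elementary hd (-c) v
  refine ⟨![u', v'], ?_⟩
  rw [Fin.sum_univ_two]
  simp only [Matrix.cons_val_zero, Matrix.cons_val_one]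
  rw [← hu', ← hv', smul_sub, neg_smul, sub_eq_add_neg]

/-- Lower semicontinuity of the relative distance at a nonzero tensor `T`. -/
theorem le_of_tendsto_of_isRelDist {ι : Type*} {l : Filter ι} [l.NeBot] {A : ι → Tensor d n}
    {T : Tensor d n} (hT : T ≠ 0) (hA : Tendsto A l (𝓝 T)) {s b : ℝ} (hs : IsRelDist T s)
    (hb : ∀ᶠ i in l, A i ≠ 0 → ∃ m ≤ b, IsRelDist (A i) m) : s ≤ b := by
  have hT' : 0 < ‖T‖ := norm_pos_iff.2 hT
  have hlim : Tendsto (fun i => (s * ‖T‖ - ‖A i - T‖) / ‖A i‖) l (𝓝 s) := by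
    have h1 : Tendsto (fun i => ‖A i - T‖) l (𝓝 0) := tendsto_iff_norm_sub_tendsto_zero.1 hA
    have := (h1.const_sub (s * ‖T‖)).div hA.norm hT'.ne'
    rwa [sub_zero, mul_div_cancel_right₀ _ hT'.ne'] at this
  refine le_of_tendsto hlim ?_
  filter_upwards [hb, hA.eventually_ne hT] with i hi hi0
  obtain ⟨m, hmb, ⟨B, hB, rfl⟩, -⟩ := hi hi0
  refine le_trans ?_ hmb
  gcongr
  have h1 : s ≤ ‖T - B‖ / ‖T‖ := hs.2 ⟨B, hB, rfl⟩
  rw [le_div_iff₀ hT'] at h1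
  have h2 : ‖T - B‖ ≤ ‖A i - T‖ + ‖A i - B‖ := by
    rw [norm_sub_rev (A i) T]
    exact norm_sub_le_norm_sub_add_norm_sub T (A i) B
  linarith

end RealTensor

theorem theorem2 (d n : ℕ) (hd : 3 ≤ d) :
    -- the strict bound for symmetric tensors of rank at most two
    (∀ A : RealTensor.Tensor d n, A ≠ 0 → RealTensor.IsSymmetric A → RealTensor.RankLE 2 A →
      ∃ m : ℝ, RealTensor.IsRelDist A m ∧ m < √(1 - (1 - 1 / (d : ℝ)) ^ (d - 1))) ∧
    (∀ hn : 2 ≤ n,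
      -- the bound is sharp: it is the supremum of the relative distances
      IsLUB {m : ℝ | ∃ A : RealTensor.Tensor d n, A ≠ 0 ∧ RealTensor.IsSymmetric A ∧
          RealTensor.RankLE 2 A ∧ RealTensor.IsRelDist A m}
        (√(1 - (1 - 1 / (d : ℝ)) ^ (d - 1))) ∧
      -- `W_d` is the limit of the difference quotients of `(e_1 + t e_2)^d`
      Tendsto (fun t : ℝ => (1 / t) •
          (RealTensor.symPow d (RealTensor.e₁ hn + t • RealTensor.e₂ hn) -
            RealTensor.symPow d (RealTensor.e₁ hn)))
        (𝓝[≠] 0) (𝓝 (RealTensor.W d hn)) ∧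
      -- equality for the (nonzero) tensor `W_d`
      RealTensor.W d hn ≠ 0 ∧ RealTensor.IsSymmetric (RealTensor.W d hn) ∧
      RealTensor.IsRelDist (RealTensor.W d hn) (√(1 - (1 - 1 / (d : ℝ)) ^ (d - 1)))) := by
  refine ⟨fun A hA hs h2 => RealTensor.exists_isRelDist_lt_of_rankLE_two hd hA hs h2, fun hn => ?_⟩
  have hd0 : 0 < d := by omega
  have hx : ‖RealTensor.e₁ hn‖ = 1 := by simp [RealTensor.e₁]
  have hy : ‖RealTensor.e₂ hn‖ = 1 := by simp [RealTensor.e₂]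
  have hxy : inner ℝ (RealTensor.e₁ hn) (RealTensor.e₂ hn) = 0 := by
    simp [RealTensor.e₁, RealTensor.e₂, EuclideanSpace.inner_single_left]
  have hW := RealTensor.W_eq_tangent hd0 hn
  have hlim := RealTensor.tendsto_symPow_slope (d := d) (RealTensor.e₁ hn) (RealTensor.e₂ hn)
  have hdist := RealTensor.isRelDist_tangent hd hx hy hxy
  rw [← hW] at hlim hdist
  have hW0 : RealTensor.W d hn ≠ 0 := by
    intro h
    have := RealTensor.norm_tangent_sq (d := d) hx hy hxy
    rw [← hW, h, norm_zero, zero_pow two_ne_zero, eq_comm, Nat.cast_eq_zero] at this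
    omega
  refine ⟨⟨?_, ?_⟩, hlim, hW0, (RealTensor.isSymmetric_symProd _).smul _, hdist⟩
  · rintro m ⟨A, hA, hs, h2, hm⟩
    obtain ⟨m', hm', hlt⟩ := RealTensor.exists_isRelDist_lt_of_rankLE_two hd hA hs h2
    exact (hm.unique hm').trans_lt hlt |>.le
  · intro b hb
    refine RealTensor.le_of_tendsto_of_isRelDist hW0 hlim hdist
      (Eventually.of_forall fun t ht => ?_)
    have hs := ((RealTensor.isSymmetric_symPow (d := d)
      (RealTensor.e₁ hn + t • RealTensor.e₂ hn)).sub
        (RealTensor.isSymmetric_symPow (RealTensor.e₁ hn))).smul (1 / t)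
    have h2 : RealTensor.RankLE 2 _ := RealTensor.rankLE_two_smul_sub hd0 (1 / t)
      (fun _ => RealTensor.e₁ hn + t • RealTensor.e₂ hn) (fun _ => RealTensor.e₁ hn)
    obtain ⟨m, hm, -⟩ := RealTensor.exists_isRelDist_lt_of_rankLE_two hd ht hs h2
    exact ⟨m, hb ⟨_, ht, hs, h2, hm⟩, hm⟩
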